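/- For a binary word $w=e_t\cdots e_2$ (most significant digit first) let $[w]=\sum_{i=2}^{t} e_iF_i$, where $F_i$ are the Fibonacci numbers; $w$ is a valid Fibonacci representation (leading zeros allowed) if it does not contain $11$. For words $x,y$ of equal length, $x\times y$ is the corresponding word over pairs of digits. Define deterministic automata $M_n$ ($n\ge 1$) recursively: $M_1$ accepts the words $x\times x$ with $x$ valid; for even $n$, $M_n$ is obtained from the formula $\exists y\; M_{n/2}(x,y)\wedge M'_{\rm add}(y,y,z)$; for odd $n\ge 3$, $M_n$ is obtained from the formula $\exists y\; M_{n-1}(x,y)\wedge M'_{\rm add}(x,y,z)$. Each formula is translated by the product construction, the projection that removes $y$, the subset construction, and minimization by Hopcroft's algorithm. Here $M'_{\rm add}$ is the 16-state Fibonacci adder for $[x]+[y]=[z]$ (dead state not counted), which in addition remembers its previous state and the last digit of $z$, and checks that $z$ contains no $11$. The time of this computation is the number of steps, where a step is the traversal of one transition or the processing of one state or of one splitter of Hopcroft's algorithm, summed over all stages of the recursion and all constructions in them, including minimization. **Theorem.** There is a constant $C$ such that for every $n\ge 1$: 1. $M_n$ is a DFA (with partial transition function) that accepts exactly the words $x\times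 y$ with $x,y$ valid Fibonacci representations and $[y]=n[x]$, and it has a self-loop on the letter $[0,0]$ at its initial state; 2. $M_n$ is computed in time at most $C\,n^6\,(\max(1,\log n))^2$, that is, in $O(n^6\log^2 n)$ time; 3. if $n\ge 2$, the subset construction in the last stage of the computation of $M_n$ produces at most $C\,n^6$ states. -/

import Mathlib

namespace FibAut

/-! ### Fibonacci representation -/

/-- A binary digit. -/
abbrev Bit : Type := Fin 2

/-- The integer `[w]` denoted by a binary word `w = e_t ⋯ e_2` (most significant digit first),
namely `∑ e_i F_i`. -/
def fibVal : List Bit → ℕ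
  | [] => 0
  | e :: w => e.val * Nat.fib (w.length + 2) + fibVal w

/-- A word is a valid Fibonacci representation (leading zeros allowed) if it has no factor `11`. -/
def Valid (w : List Bit) : Prop := ¬ [1, 1] <:+: w

/-- The words `x × y` (of pairs of digits) such that `x`, `y` are valid Fibonacci representations
and `[y] = n [x]`. -/
def mulLanguage (n : ℕ) : Language (Bit × Bit) :=
  {w | Valid (w.map Prod.fst) ∧ Valid (w.map Prod.snd) ∧
    fibVal (w.map Prod.snd) = n * fibVal (w.map Prod.fst)}

/-! ### Computations with a step count -/

/-- The result of a computation, with the number of steps it took. -/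
structure Timed (α : Type) where
  val : α
  time : ℕ

instance : Monad Timed where
  pure a := ⟨a, 0⟩
  bind x f := ⟨(f x.val).val, x.time + (f x.val).time⟩

/-- Spend `k` steps. -/
def tick (k : ℕ) : Timed Unit := ⟨(), k⟩

/-! ### Finite automata given by explicit transition tables -/

/-- A finite automaton with alphabet `A` and states in `S`: a list of states, an initial state,
a list of transitions `(source, letter, target)` and a list of accepting states. -/
structure FA (A S : Type) where
  states : List S
  start : S
  trans : List (S × A × S)
  final : List S

/-- The automaton as an NFA. -/
def FA.toNFA {A S : Type} (M : FA A S) : NFA A S where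
  step p a := {q | (p, a, q) ∈ M.trans}
  start := {M.start}
  accept := {q | q ∈ M.final}

/-- The table is that of a DFA with partial transition function: no state is listed twice,
the initial state, the accepting states and the ends of all transitions are listed, and from each
state there is at most one transition on each letter. -/
structure FA.IsDFA {A S : Type} (M : FA A S) : Prop where
  nodup : M.states.Nodup
  start_mem : M.start ∈ M.states
  final_mem : ∀ q ∈ M.final, q ∈ M.states
  trans_mem : ∀ t ∈ M.trans, t.1 ∈ M.states ∧ t.2.2 ∈ M.states
  det : ∀ p a q r, (p, a, q) ∈ M.trans → (p, a, r) ∈ M.trans → q = r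

section Algorithms

variable {A B S T : Type} [DecidableEq A] [DecidableEq B] [DecidableEq S] [DecidableEq T]

/-- The transitions leaving a state. -/
def FA.out (M : FA A S) (p : S) : List (S × A × S) := M.trans.filter fun t => t.1 = p

/-- The transitions entering a state. -/
def FA.inc (M : FA A S) (q : S) : List (S × A × S) := M.trans.filter fun t => t.2.2 = q

/-- Worklist exploration of a transition graph. The arguments after `succ` are a bound on the number
of iterations, the states still to be expanded, all states found so far, and the transitions
found so far. Expanding a state costs one step plus the cost of `succ`. -/
def explore (succ : S → Timed (List (A × S))) :
    ℕ → List S → List S → List (S × A × S) → Timed (List S × List (S × A × S))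
  | 0, _, found, tr => pure (found, tr)
  | _ + 1, [], found, tr => pure (found, tr)
  | k + 1, s :: todo, found, tr => do
    tick 1
    let nexts ← succ s
    let new := (nexts.map Prod.snd).dedup.filter fun q => q ∉ found
    explore succ k (todo ++ new) (found ++ new) (tr ++ nexts.map fun aq => (s, aq))

/-- Product construction, restricted to accessible states. The letter `a` of `M` and the letter `b`
of `N` are read together, as the letter `c`, if `sync a b = some c`. Every pair of transitions that
is inspected costs one step. -/
def product {C : Type} (sync : A → B → Option C) (M : FA A S) (N : FA B T) :
    Timed (FA C (S × T)) := do
  let r ← explore (A := C)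
    (fun s => do
      let pairs := M.out s.1 ×ˢ N.out s.2
      tick pairs.length
      return pairs.filterMap fun tu =>
        (sync tu.1.2.1 tu.2.2.1).map fun c => (c, (tu.1.2.2, tu.2.2.2)))
    (M.states.length * N.states.length) [(M.start, N.start)] [(M.start, N.start)] []
  return {
    states := r.1
    start := (M.start, N.start)
    trans := r.2
    final := r.1.filter fun s => s.1 ∈ M.final ∧ s.2 ∈ N.final }

/-- Relabelling of the transitions along a map of alphabets (a projection removes a component of the
input, and gives a nondeterministic automaton). Every transition costs one step. -/
def relabel {C : Type} (f : A → C) (M : FA A S) : Timed (FA C S) := do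
  tick M.trans.length
  return {
    states := M.states
    start := M.start
    trans := M.trans.map fun t => (t.1, f t.2.1, t.2.2)
    final := M.final }

/-- Subset construction, restricted to accessible and nonempty sets of states. Every transition
of `M` that is followed and every transition that is created costs one step. -/
def determinize (letters : List A) (M : FA A S) : Timed (FA A (Finset S)) := do
  let r ← explore
    (fun U : Finset S => do
      let followed := M.trans.filter fun t => t.1 ∈ U
      tick followed.length
      let nexts := (letters.map fun a =>
        (a, ((followed.filter fun t => t.2.1 = a).map fun t => t.2.2).toFinset)).filter
          fun aV => aV.2 ≠ ∅
      tick nexts.length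
      return nexts)
    (2 ^ M.states.length) [{M.start}] [{M.start}] []
  return {
    states := r.1
    start := {M.start}
    trans := r.2
    final := r.1.filter fun U => ∃ q ∈ M.final, q ∈ U }

/-- Removal of the states that are not co-accessible: they are found by following the transitions
backwards from the accepting states, one step for each state and each transition; then every
transition is inspected once. -/
def trim (M : FA A S) : Timed (FA A S) := do
  let r ← explore
    (fun q => do
      let back := M.inc q
      tick back.length
      return back.map fun t => (t.2.1, t.1))
    M.states.length M.final M.final []
  tick M.trans.length
  return {
    states := M.states.filter fun q => q ∈ r.1
    start := M.start
    trans := M.trans.filter fun t => t.1 ∈ r.1 ∧ t.2.2 ∈ r.1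
    final := M.final }

/-- Split the block `Y` along the set `X`. -/
def splitBlock (X Y : Finset S) : List (Finset S) :=
  if Y ∩ X ≠ ∅ ∧ Y \ X ≠ ∅ then [Y ∩ X, Y \ X] else [Y]

/-- The smaller half of the block `Y` split along `X`. -/
def smallerHalf (X Y : Finset S) : Finset S :=
  if (Y ∩ X).card ≤ (Y \ X).card then Y ∩ X else Y \ X

/-- The main loop of Hopcroft's partition refinement. The arguments after `M` are a bound on the
number of iterations, the current partition, and the list of the splitters (pairs of a block and a
letter) still to be processed. Processing the splitter `(B, a)` costs one step, plus one step for
each transition on `a` into `B`. When a block is split, a splitter waiting in the list is replaced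
by its two halves; for the other letters the smaller half is added to the list. -/
def refine (letters : List A) (M : FA A S) :
    ℕ → List (Finset S) → List (Finset S × A) → Timed (List (Finset S))
  | 0, P, _ => pure P
  | _ + 1, P, [] => pure P
  | k + 1, P, (B, a) :: W => do
    let scanned := M.trans.filter fun t => t.2.1 = a ∧ t.2.2 ∈ B
    tick (1 + scanned.length)
    let X := (scanned.map fun t => t.1).toFinset
    let waiting := W.flatMap fun Yc => (splitBlock X Yc.1).map fun Z => (Z, Yc.2)
    let added := P.flatMap fun Y =>
      if Y ∩ X ≠ ∅ ∧ Y \ X ≠ ∅ then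
        (letters.filter fun c => (Y, c) ∉ W).map fun c => (smallerHalf X Y, c)
      else []
    refine letters M k (P.flatMap (splitBlock X)) (waiting ++ added)

/-- Hopcroft's minimization algorithm for a deterministic automaton all of whose states are
accessible: remove the states that are not co-accessible, refine the partition into accepting and
non-accepting states, and form the quotient, whose states are the numbers of the blocks. The initial
partition costs one step for each state, the quotient one step for each transition. -/
def minimize (letters : List A) (M : FA A S) : Timed (FA A ℕ) := do
  let N ← trim M
  tick N.states.length
  let P₀ := [(N.states.filter fun q => q ∈ N.final).toFinset,
    (N.states.filter fun q => q ∉ N.final).toFinset].filter fun Y => Y ≠ ∅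
  let P ← refine letters N (letters.length * (N.states.length + 2)) P₀ (P₀ ×ˢ letters)
  tick N.trans.length
  let cls := fun q : S => P.findIdx fun Y => q ∈ Y
  return {
    states := List.range P.length
    start := cls N.start
    trans := (N.trans.map fun t => (cls t.1, t.2.1, cls t.2.2)).dedup
    final := (N.final.map cls).dedup }

end Algorithms

/-! ### The adder -/

/-- The digits. -/
def bits : List Bit := [0, 1]

/-- Pairs of digits. -/
def pairs : List (Bit × Bit) := bits ×ˢ bits

/-- Triples of digits. -/
def triples : List (Bit × Bit × Bit) := bits ×ˢ pairs

/-- After reading `x × y × z`, the adder is in the state denoted by the sequence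
`s(k) = [x0^k] + [y0^k] - [z0^k]`. It obeys `s(k + 2) = s(k + 1) + s(k)`, and is given here by the
pair `(s(0), s(1))`. -/
abbrev AddState : Type := ℤ × ℤ

/-- The sequence `s` after one more letter `(a, b, e)`: with `c = a + b - e`, the new first two
terms are `s(1) + c` and `s(2) + 2 c`. -/
def addNext (s : AddState) (l : Bit × Bit × Bit) : AddState :=
  let c : ℤ := (l.1.val : ℤ) + (l.2.1.val : ℤ) - (l.2.2.val : ℤ)
  (s.2 + c, s.1 + s.2 + 2 * c)

/-- The 16 states that are not dead. -/
def addStates : List AddState :=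
  [(0, 0), (0, 1), (0, -1), (1, 1), (1, 2), (1, 3), (2, 2), (-1, -1), (-1, -2), (-2, -2), (-2, -3),
    (-2, -4), (-3, -4), (-3, -5), (-3, -6), (-4, -5)]

/-- The adder `M_add`, accepting the words `x × y × z` with `[x] + [y] = [z]`. -/
def adder : FA (Bit × Bit × Bit) AddState where
  states := addStates
  start := (0, 0)
  trans := ((addStates ×ˢ triples).map fun sl => (sl.1, sl.2, addNext sl.1 sl.2)).filter
    fun t => t.2.2 ∈ addStates
  final := addStates.filter fun s => s.1 = 0

/-- The adder `M_add'`, with states `(s, s', e)`: the present state `s` of `M_add`, its previous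
state `s'`, and the last digit `e` of `z`. There is no transition on a second consecutive `1`
in `z`. Every transition of `M_add` that is followed costs one step. -/
def adder' : Timed (FA (Bit × Bit × Bit) (AddState × AddState × Bit)) := do
  let q₀ : AddState × AddState × Bit := ((0, 0), (0, 0), 0)
  let r ← explore
    (fun q : AddState × AddState × Bit => do
      let followed := adder.out q.1
      tick followed.length
      return (followed.filter fun t => ¬ (q.2.2 = 1 ∧ t.2.1.2.2 = 1)).map
        fun t => (t.2.1, (t.2.2, q.1, t.2.1.2.2)))
    (2 * addStates.length ^ 2) [q₀] [q₀] []
  return {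
    states := r.1
    start := q₀
    trans := r.2
    final := r.1.filter fun q => q.1 ∈ adder.final }

/-! ### The recursive construction of an automaton for `[y] = n [x]` -/

/-- States of the product of an automaton reading `x × y` with `M_add'`. -/
abbrev ProdState : Type := ℕ × AddState × AddState × Bit

/-- A letter `(a, b)` of `x × y` and a letter of `y × y × z` that agree on `y`. -/
def syncDouble (l : Bit × Bit) (m : Bit × Bit × Bit) : Option (Bit × Bit × Bit) :=
  if m.1 = l.2 ∧ m.2.1 = l.2 then some (l.1, l.2, m.2.2) else none

/-- A letter `(a, b)` of `x × y` and a letter of `x × y × z` that agree on `x` and `y`. -/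
def syncAdd (l : Bit × Bit) (m : Bit × Bit × Bit) : Option (Bit × Bit × Bit) :=
  if m.1 = l.1 ∧ m.2.1 = l.2 then some (l.1, l.2, m.2.2) else none

/-- The determinized automaton for the formula `∃ y, M(x, y) ∧ M_add'(y, y, z)` (if `sync` is
`syncDouble`) or `∃ y, M(x, y) ∧ M_add'(x, y, z)` (if `sync` is `syncAdd`): build `M_add'`, form the
product, project away `y`, apply the subset construction. -/
def existsStep (sync : Bit × Bit → Bit × Bit × Bit → Option (Bit × Bit × Bit))
    (M : FA (Bit × Bit) ℕ) : Timed (FA (Bit × Bit) (Finset ProdState)) := do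
  let add ← adder'
  let prod ← product sync M add
  let nfa ← relabel (fun l : Bit × Bit × Bit => (l.1, l.2.2)) prod
  determinize pairs nfa

/-- The automaton for `[y] = [x]`: both inputs are the same valid word. -/
def equality : FA (Bit × Bit) ℕ where
  states := [0, 1]
  start := 0
  trans := [(0, (0, 0), 0), (0, (1, 1), 1), (1, (0, 0), 0)]
  final := [0, 1]

/-- The automaton for `[y] = n [x]`, for `n ≥ 1`, built from the one for `n / 2` if `n` is even,
and from the one for `n - 1` if `n > 1` is odd; each determinized automaton is minimized. The
automaton for `n = 1` costs one step for each of its transitions. -/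
def mulFA : ℕ → Timed (FA (Bit × Bit) ℕ)
  | 0 => ⟨equality, equality.trans.length⟩
  | 1 => ⟨equality, equality.trans.length⟩
  | n + 2 =>
    if (n + 2) % 2 = 0 then do
      let M ← mulFA ((n + 2) / 2)
      let D ← existsStep syncDouble M
      minimize pairs D
    else do
      let M ← mulFA (n + 1)
      let D ← existsStep syncAdd M
      minimize pairs D

/-- The automaton that the subset construction yields in the last stage of the construction of
`mulFA n`, for `n ≥ 2`. -/
def subsetFA (n : ℕ) : FA (Bit × Bit) (Finset ProdState) :=
  if n % 2 = 0 then (existsStep syncDouble (mulFA (n / 2)).val).val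
  else (existsStep syncAdd (mulFA (n - 1)).val).val

end FibAut

/-! Reading a word letter by letter, with an integer coefficient attached to each letter, gives a
sequence s(k), the value of the word followed by k zeros. It obeys the Fibonacci recurrence, so the
pair (s(0), s(1)) determines it. For the coefficients of [y] - n[x], this pair and the last digits
of x and y decide which continuations of a valid prefix lie in the language
(`append_mem_mulLanguage`). A minimal automaton therefore has at most one state per such key.

Only O(n^2) keys matter. With φ the golden ratio and ψ its conjugate, s(1) - φ s(0) becomes ψ (s(1)
- φ s(0)) + c ψ^2 on a letter with coefficient c. Since |ψ| + ψ^2 = 1, it stays bounded by n in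
absolute value. If s(0) is too large in absolute value, the sequence can never return to 0, so a
prefix that can be completed has both terms of size O(n) (`seqRun_bounded`).

The same principle bounds the subset construction (`IsStage.existsStep_states_length_le`). Let a
stage lead from [y] = m[x] to [z] = n[x]. The sequence of [z] - n[x] plus that of the adder is k
times the sequence of [y] - m[x], with k = 1 or 2. Hence, once x × z is read, the adder state and
the last digit of y determine the state of the old automaton. A subset is thus encoded by the pair
of [z] - n[x], the last digit of x, and a subset of a fixed finite set, which leaves O(n^2) subsets.

The rest is correctness of the algorithms and counting. The language of a stage is right because
m[x] ≤ [z] has a valid representation of the same length as z, and because the 16 adder states omit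
only sums that can never return to 0. For Hopcroft's algorithm, `RefineInv.step` preserves the
partition invariant, and a potential bounds the number of splitters by O(n^2). Charging all
transitions to each subset and to each splitter gives O(n^4) per stage. Each stage comes from a
smaller multiplier, so the total is O(n^5), which lies within the required bound; of the logarithmic
factor only the fact that it is at least 1 is used. -/

namespace FibAut

/-! ### Values and step counts of composed computations -/

section Timing

variable {α β : Type}

@[simp] theorem Timed.val_pure (a : α) : (pure a : Timed α).val = a := rfl

@[simp] theorem Timed.time_pure (a : α) : (pure a : Timed α).time = 0 := rfl

@[simp] theorem Timed.val_bind (x : Timed α) (f : α → Timed β) :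
    (x >>= f).val = (f x.val).val := rfl

@[simp] theorem Timed.time_bind (x : Timed α) (f : α → Timed β) :
    (x >>= f).time = x.time + (f x.val).time := rfl

@[simp] theorem tick_time (k : ℕ) : (tick k).time = k := rfl

end Timing

/-! ### Paths and accepted words -/

section Paths

variable {A S : Type}

/-- `M.Path p w q` says that `M` can go from `p` to `q` reading `w`. -/
def FA.Path (M : FA A S) : S → List A → S → Prop
  | p, [], q => p = q
  | p, a :: w, q => ∃ r, (p, a, r) ∈ M.trans ∧ M.Path r w q

@[simp] theorem FA.path_nil {M : FA A S} {p q : S} : M.Path p [] q ↔ p = q := Iff.rfl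

@[simp] theorem FA.path_cons {M : FA A S} {p q : S} {a : A} {w : List A} :
    M.Path p (a :: w) q ↔ ∃ r, (p, a, r) ∈ M.trans ∧ M.Path r w q := Iff.rfl

theorem FA.path_append {M : FA A S} {p q : S} {v w : List A} :
    M.Path p (v ++ w) q ↔ ∃ r, M.Path p v r ∧ M.Path r w q := by
  induction v generalizing p with
  | nil => simp
  | cons a v ih =>
    simp only [List.cons_append, FA.path_cons, ih]
    constructor
    · rintro ⟨r, h, s, h1, h2⟩
      exact ⟨s, ⟨r, h, h1⟩, h2⟩
    · rintro ⟨s, ⟨r, h, h1⟩, h2⟩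
      exact ⟨r, h, s, h1, h2⟩

theorem FA.path_concat {M : FA A S} {p q : S} {v : List A} {a : A} :
    M.Path p (v ++ [a]) q ↔ ∃ r, M.Path p v r ∧ (r, a, q) ∈ M.trans := by
  simp [FA.path_append]

theorem FA.mem_evalFrom {M : FA A S} {X : Set S} {w : List A} {q : S} :
    q ∈ M.toNFA.evalFrom X w ↔ ∃ p ∈ X, M.Path p w q := by
  induction w generalizing X with
  | nil => simp
  | cons a w ih =>
    rw [NFA.evalFrom_cons, ih]
    constructor
    · rintro ⟨r, hr, h⟩
      obtain ⟨p, hp, hpr⟩ := NFA.mem_stepSet.1 hr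
      exact ⟨p, hp, r, hpr, h⟩
    · rintro ⟨p, hp, r, hpr, h⟩
      exact ⟨r, NFA.mem_stepSet.2 ⟨p, hp, hpr⟩, h⟩

/-- The words that `M` accepts from the state `p`. -/
def FA.Acc (M : FA A S) (p : S) (w : List A) : Prop := ∃ q ∈ M.final, M.Path p w q

theorem FA.mem_accepts {M : FA A S} {w : List A} :
    w ∈ M.toNFA.accepts ↔ M.Acc M.start w := by
  have : w ∈ M.toNFA.accepts ↔ ∃ q ∈ M.final, q ∈ M.toNFA.evalFrom {M.start} w := Iff.rfl
  rw [this]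
  simp only [FA.mem_evalFrom, Set.mem_singleton_iff, exists_eq_left, FA.Acc]

theorem FA.acc_append {M : FA A S} {p : S} {v w : List A} :
    M.Acc p (v ++ w) ↔ ∃ r, M.Path p v r ∧ M.Acc r w := by
  simp only [FA.Acc, FA.path_append]
  constructor
  · rintro ⟨q, hq, r, h1, h2⟩
    exact ⟨r, h1, q, hq, h2⟩
  · rintro ⟨r, h1, q, hq, h2⟩
    exact ⟨q, hq, r, h1, h2⟩

theorem FA.acc_cons {M : FA A S} {p : S} {a : A} {w : List A} :
    M.Acc p (a :: w) ↔ ∃ r, (p, a, r) ∈ M.trans ∧ M.Acc r w := by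
  simpa using FA.acc_append (M := M) (p := p) (v := [a]) (w := w)

theorem FA.IsDFA.path_unique {M : FA A S} (h : M.IsDFA) {p q r : S} {w : List A}
    (hq : M.Path p w q) (hr : M.Path p w r) : q = r := by
  induction w generalizing p with
  | nil => exact (FA.path_nil.1 hq).symm.trans (FA.path_nil.1 hr)
  | cons a w ih =>
    obtain ⟨s, hs, hq⟩ := hq
    obtain ⟨t, ht, hr⟩ := hr
    obtain rfl := h.det _ _ _ _ hs ht
    exact ih hq hr

theorem FA.IsDFA.acc_append {M : FA A S} (h : M.IsDFA) {p r : S} {v w : List A}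
    (hv : M.Path p v r) : M.Acc p (v ++ w) ↔ M.Acc r w := by
  rw [FA.acc_append]
  exact ⟨fun ⟨s, hs, hw⟩ => h.path_unique hs hv ▸ hw, fun hw => ⟨r, hv, hw⟩⟩

/-- Every listed state is reached from the initial state. -/
def FA.Accessible (M : FA A S) : Prop := ∀ q ∈ M.states, ∃ w, M.Path M.start w q

/-- From every listed state some word is accepted. -/
def FA.Coaccessible (M : FA A S) : Prop := ∀ q ∈ M.states, ∃ w, M.Acc q w

theorem FA.path_mem {M : FA A S} (ht : ∀ t ∈ M.trans, t.1 ∈ M.states ∧ t.2.2 ∈ M.states)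
    {p q : S} {w : List A} (hp : p ∈ M.states) (h : M.Path p w q) : q ∈ M.states := by
  induction w generalizing p with
  | nil => exact FA.path_nil.1 h ▸ hp
  | cons a w ih =>
    obtain ⟨r, hr, h⟩ := h
    exact ih (ht _ hr).2 h

end Paths

/-! ### Worklist exploration -/

section Explore

variable {A S : Type}

/-- The transitions leaving the states of a list. -/
def edges (succ : S → Timed (List (A × S))) (l : List S) : List (S × A × S) :=
  l.flatMap fun s => (succ s).val.map fun aq => (s, aq)

theorem mem_edges {succ : S → Timed (List (A × S))} {l : List S} {t : S × A × S} :
    t ∈ edges succ l ↔ t.1 ∈ l ∧ t.2 ∈ (succ t.1).val := by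
  obtain ⟨p, a, q⟩ := t
  simp only [edges, List.mem_flatMap, List.mem_map, Prod.mk.injEq]
  constructor
  · rintro ⟨s, hs, e, he, rfl, rfl⟩
    exact ⟨hs, he⟩
  · rintro ⟨hs, he⟩
    exact ⟨p, hs, _, he, rfl, rfl⟩

/-- The outcome of an exploration that was not cut short. -/
structure Explored (succ : S → Timed (List (A × S))) (init : List S)
    (r : Timed (List S × List (S × A × S))) : Prop where
  nodup : r.val.1.Nodup
  init_mem : ∀ s ∈ init, s ∈ r.val.1
  closed : ∀ s ∈ r.val.1, ∀ e ∈ (succ s).val, e.2 ∈ r.val.1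
  trans_eq : r.val.2 = edges succ r.val.1
  time_eq : r.time = (r.val.1.map fun s => 1 + (succ s).time).sum
  induct : ∀ Q : S → Prop, (∀ s ∈ init, Q s) → (∀ s, Q s → ∀ e ∈ (succ s).val, Q e.2) →
    ∀ s ∈ r.val.1, Q s

/-- The states found are always `done ++ todo`, and the transitions found are those leaving `done`.
Each iteration moves one state into `done`, which has no repetitions and stays inside the closed set
`B`; so when the iteration bound is used up, `done` fills `B` and nothing is left to expand. -/
theorem explore_aux [DecidableEq S] (succ : S → Timed (List (A × S))) (B : Finset S)
    (hB : ∀ s ∈ B, ∀ e ∈ (succ s).val, e.2 ∈ B) (k : ℕ) (done todo : List S)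
    (hnd : (done ++ todo).Nodup) (hsub : ∀ s ∈ done ++ todo, s ∈ B)
    (hcl : ∀ s ∈ done, ∀ e ∈ (succ s).val, e.2 ∈ done ++ todo)
    (hk : B.card ≤ k + done.length) :
    let r := explore succ k todo (done ++ todo) (edges succ done)
    r.val.1.Nodup ∧ (∀ s ∈ done ++ todo, s ∈ r.val.1) ∧
      (∀ s ∈ r.val.1, ∀ e ∈ (succ s).val, e.2 ∈ r.val.1) ∧
      r.val.2 = edges succ r.val.1 ∧
      (done.map fun s => 1 + (succ s).time).sum + r.time =
        (r.val.1.map fun s => 1 + (succ s).time).sum ∧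
      (∀ Q : S → Prop, (∀ s ∈ done ++ todo, Q s) → (∀ s, Q s → ∀ e ∈ (succ s).val, Q e.2) →
        ∀ s ∈ r.val.1, Q s) := by
  induction k generalizing done todo with
  | zero =>
    have hlen : (done ++ todo).length ≤ B.card := by
      rw [← List.toFinset_card_of_nodup hnd]
      exact Finset.card_le_card fun s hs => hsub s (List.mem_toFinset.1 hs)
    obtain rfl : todo = [] := by
      rw [List.length_append] at hlen
      exact List.length_eq_zero_iff.1 (by omega)
    simp only [List.append_nil] at hnd hcl
    simp only [explore, List.append_nil, Timed.val_pure, Timed.time_pure]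
    exact ⟨hnd, fun s hs => hs, hcl, trivial, by simp, fun Q h _ => h⟩
  | succ k ih =>
    cases todo with
    | nil =>
      simp only [List.append_nil] at hnd hcl
      simp only [explore, List.append_nil, Timed.val_pure, Timed.time_pure]
      exact ⟨hnd, fun s hs => hs, hcl, trivial, by simp, fun Q h _ => h⟩
    | cons s todo =>
      set new := (((succ s).val.map Prod.snd).dedup).filter fun q => q ∉ done ++ s :: todo with hnew
      have hmem : ∀ q, q ∈ new ↔ (∃ e ∈ (succ s).val, e.2 = q) ∧ q ∉ done ++ s :: todo := by
        intro q
        simp [hnew]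
      have e1 : done ++ s :: todo ++ new = (done ++ [s]) ++ (todo ++ new) := by simp
      have e2 : edges succ done ++ ((succ s).val.map fun aq => (s, aq)) =
          edges succ (done ++ [s]) := by
        simp [edges]
      have hrec := ih (done ++ [s]) (todo ++ new) ?_ ?_ ?_ ?_
      · simp only [explore, Timed.val_bind, Timed.time_bind, tick_time]
        rw [← hnew, e1, e2]
        obtain ⟨h1, h2, h3, h4, h5, h6⟩ := hrec
        refine ⟨h1, fun q hq => h2 q ?_, h3, h4, ?_, fun Q hQ hs => h6 Q ?_ hs⟩
        · rw [← e1]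
          exact List.mem_append_left _ hq
        · rw [← h5]
          simp only [List.map_append, List.map_cons, List.map_nil, List.sum_append, List.sum_cons,
            List.sum_nil]
          omega
        · intro q hq
          rw [← e1, List.mem_append] at hq
          rcases hq with hq | hq
          · exact hQ q hq
          · obtain ⟨⟨e, he, rfl⟩, -⟩ := (hmem q).1 hq
            exact hs s (hQ s (by simp)) e he
      · rw [← e1]
        refine List.Nodup.append hnd ((List.nodup_dedup _).filter _) ?_
        intro q hq hq'
        exact ((hmem q).1 hq').2 hq
      · intro q hq
        rw [← e1, List.mem_append] at hq
        rcases hq with hq | hq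
        · exact hsub q hq
        · obtain ⟨⟨e, he, rfl⟩, -⟩ := (hmem q).1 hq
          exact hB s (hsub s (by simp)) e he
      · intro q hq e he
        rw [← e1, List.mem_append, hmem]
        rw [List.mem_append, List.mem_singleton] at hq
        by_cases h : e.2 ∈ done ++ s :: todo
        · exact Or.inl h
        · rcases hq with hq | rfl
          · exact Or.inl (hcl q hq e he)
          · exact Or.inr ⟨⟨e, he, rfl⟩, h⟩
      · rw [List.length_append, List.length_singleton]
        omega

theorem explore_spec [DecidableEq S] (succ : S → Timed (List (A × S))) (init : List S)
    (B : Finset S) (k : ℕ) (hnd : init.Nodup) (hinit : ∀ s ∈ init, s ∈ B)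
    (hB : ∀ s ∈ B, ∀ e ∈ (succ s).val, e.2 ∈ B) (hk : B.card ≤ k) :
    Explored succ init (explore succ k init init []) := by
  obtain ⟨h1, h2, h3, h4, h5, h6⟩ := explore_aux succ B hB k [] init (by simpa using hnd)
    (by simpa using hinit) (by simp) (by simpa using hk)
  exact ⟨h1, h2, h3, h4, (Nat.zero_add _).symm.trans h5, h6⟩

theorem Explored.mem_trans {succ : S → Timed (List (A × S))} {init : List S}
    {r : Timed (List S × List (S × A × S))} (h : Explored succ init r) {t : S × A × S} :
    t ∈ r.val.2 ↔ t.1 ∈ r.val.1 ∧ t.2 ∈ (succ t.1).val := by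
  rw [h.trans_eq, mem_edges]

theorem Explored.time_le {succ : S → Timed (List (A × S))} {init : List S}
    {r : Timed (List S × List (S × A × S))} (h : Explored succ init r) {c : ℕ}
    (hc : ∀ s ∈ r.val.1, (succ s).time ≤ c) : r.time ≤ r.val.1.length * (1 + c) := by
  rw [h.time_eq]
  refine (List.sum_le_card_nsmul _ (1 + c) ?_).trans (by simp)
  intro x hx
  obtain ⟨s, hs, rfl⟩ := List.mem_map.1 hx
  exact Nat.add_le_add_left (hc s hs) 1

theorem Explored.trans_length_le {succ : S → Timed (List (A × S))} {init : List S}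
    {r : Timed (List S × List (S × A × S))} (h : Explored succ init r) {c : ℕ}
    (hc : ∀ s ∈ r.val.1, (succ s).val.length ≤ c) : r.val.2.length ≤ r.val.1.length * c := by
  rw [h.trans_eq, edges, List.length_flatMap]
  refine (List.sum_le_card_nsmul _ c ?_).trans (by simp)
  intro x hx
  obtain ⟨s, hs, rfl⟩ := List.mem_map.1 hx
  simpa using hc s hs

end Explore

/-! ### Product construction -/

section Product

variable {A B C S T : Type} [DecidableEq S] [DecidableEq T]

/-- The letters read from a state of the product, and the states they lead to. -/
def productSucc (sync : A → B → Option C) (M : FA A S) (N : FA B T) (s : S × T) :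
    Timed (List (C × (S × T))) := do
  let pairs := M.out s.1 ×ˢ N.out s.2
  tick pairs.length
  return pairs.filterMap fun tu =>
    (sync tu.1.2.1 tu.2.2.1).map fun c => (c, (tu.1.2.2, tu.2.2.2))

/-- The exploration in the product construction. -/
def productRun (sync : A → B → Option C) (M : FA A S) (N : FA B T) :
    Timed (List (S × T) × List ((S × T) × C × (S × T))) :=
  explore (productSucc sync M N) (M.states.length * N.states.length)
    [(M.start, N.start)] [(M.start, N.start)] []

theorem FA.mem_out {M : FA A S} {p : S} {t : S × A × S} :
    t ∈ M.out p ↔ t ∈ M.trans ∧ t.1 = p := by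
  simp [FA.out]

variable {sync : A → B → Option C} {M : FA A S} {N : FA B T} {g : C → A} {h : C → B}

theorem mem_productSucc (hs : ∀ l m c, sync l m = some c ↔ l = g c ∧ m = h c)
    {s : S × T} {e : C × (S × T)} :
    e ∈ (productSucc sync M N s).val ↔
      (s.1, g e.1, e.2.1) ∈ M.trans ∧ (s.2, h e.1, e.2.2) ∈ N.trans := by
  obtain ⟨c, q, r⟩ := e
  simp only [productSucc, Timed.val_bind, Timed.val_pure, List.mem_filterMap, Option.map_eq_some_iff,
    hs, Prod.exists, List.mem_product, FA.mem_out, Prod.mk.injEq]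
  constructor
  · rintro ⟨_, _, _, _, _, _, ⟨⟨h1, rfl⟩, h2, rfl⟩, c, ⟨rfl, rfl⟩, rfl, rfl, rfl⟩
    exact ⟨h1, h2⟩
  · rintro ⟨h1, h2⟩
    exact ⟨_, _, _, _, _, _, ⟨⟨h1, rfl⟩, h2, rfl⟩, c, ⟨rfl, rfl⟩, rfl, rfl, rfl⟩

theorem product_explored (hM : M.IsDFA) (hN : N.IsDFA)
    (hs : ∀ l m c, sync l m = some c ↔ l = g c ∧ m = h c) :
    Explored (productSucc sync M N) [(M.start, N.start)] (productRun sync M N) := by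
  refine explore_spec _ _ (M.states.toFinset ×ˢ N.states.toFinset) _ (by simp) ?_ ?_ ?_
  · simpa using ⟨hM.start_mem, hN.start_mem⟩
  · intro s _ e he
    rw [mem_productSucc hs] at he
    simpa using ⟨(hM.trans_mem _ he.1).2, (hN.trans_mem _ he.2).2⟩
  · rw [Finset.card_product]
    exact Nat.mul_le_mul (List.toFinset_card_le _) (List.toFinset_card_le _)

theorem mem_product_trans (hM : M.IsDFA) (hN : N.IsDFA)
    (hs : ∀ l m c, sync l m = some c ↔ l = g c ∧ m = h c) {p q : S × T} {c : C} :
    (p, c, q) ∈ (product sync M N).val.trans ↔ p ∈ (product sync M N).val.states ∧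
      (p.1, g c, q.1) ∈ M.trans ∧ (p.2, h c, q.2) ∈ N.trans := by
  have := (product_explored hM hN hs).mem_trans (t := (p, c, q))
  rw [mem_productSucc hs] at this
  exact this

theorem product_start_mem (hM : M.IsDFA) (hN : N.IsDFA)
    (hs : ∀ l m c, sync l m = some c ↔ l = g c ∧ m = h c) :
    (product sync M N).val.start ∈ (product sync M N).val.states :=
  (product_explored hM hN hs).init_mem _ (List.mem_singleton_self _)

theorem product_trans_mem (hM : M.IsDFA) (hN : N.IsDFA)
    (hs : ∀ l m c, sync l m = some c ↔ l = g c ∧ m = h c) :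
    ∀ t ∈ (product sync M N).val.trans, t.1 ∈ (product sync M N).val.states ∧
      t.2.2 ∈ (product sync M N).val.states := by
  intro t ht
  have := ((product_explored hM hN hs).mem_trans (t := t)).1 ht
  exact ⟨this.1, (product_explored hM hN hs).closed _ this.1 _ this.2⟩

/-- The table holds only transitions that leave explored states. Paths are therefore taken from the
initial state and extended at their right end, which keeps every source explored. -/
theorem product_path (hM : M.IsDFA) (hN : N.IsDFA)
    (hs : ∀ l m c, sync l m = some c ↔ l = g c ∧ m = h c) {w : List C} {q : S × T} :
    (product sync M N).val.Path (product sync M N).val.start w q ↔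
      M.Path M.start (w.map g) q.1 ∧ N.Path N.start (w.map h) q.2 := by
  induction w using List.reverseRecOn generalizing q with
  | nil => exact Prod.ext_iff
  | append_singleton w c ih =>
    rw [FA.path_concat]
    simp only [ih, List.map_append, List.map_cons, List.map_nil, FA.path_concat,
      mem_product_trans hM hN hs]
    constructor
    · rintro ⟨r, ⟨h1, h2⟩, -, h3, h4⟩
      exact ⟨⟨_, h1, h3⟩, _, h2, h4⟩
    · rintro ⟨⟨r, h1, h3⟩, s, h2, h4⟩
      exact ⟨(r, s), ⟨h1, h2⟩, FA.path_mem (product_trans_mem hM hN hs)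
        (product_start_mem hM hN hs) (ih.2 ⟨h1, h2⟩), h3, h4⟩

theorem product_acc (hM : M.IsDFA) (hN : N.IsDFA)
    (hs : ∀ l m c, sync l m = some c ↔ l = g c ∧ m = h c) {w : List C} :
    (product sync M N).val.Acc (product sync M N).val.start w ↔
      M.Acc M.start (w.map g) ∧ N.Acc N.start (w.map h) := by
  have hf : ∀ q, q ∈ (product sync M N).val.final ↔
      q ∈ (product sync M N).val.states ∧ q.1 ∈ M.final ∧ q.2 ∈ N.final := by
    intro q
    refine (List.mem_filter (as := (product sync M N).val.states)).trans ?_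
    simp
  simp only [FA.Acc, hf]
  constructor
  · rintro ⟨q, ⟨-, h1, h2⟩, hq⟩
    rw [product_path hM hN hs] at hq
    exact ⟨⟨_, h1, hq.1⟩, _, h2, hq.2⟩
  · rintro ⟨⟨p, h1, hp⟩, q, h2, hq⟩
    have := (product_path hM hN hs (q := (p, q))).2 ⟨hp, hq⟩
    exact ⟨(p, q), ⟨FA.path_mem (product_trans_mem hM hN hs)
        (product_start_mem hM hN hs) this, h1, h2⟩, this⟩

theorem product_states_length (hM : M.IsDFA) (hN : N.IsDFA)
    (hs : ∀ l m c, sync l m = some c ↔ l = g c ∧ m = h c) :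
    (product sync M N).val.states.length ≤ M.states.length * N.states.length := by
  have hE := product_explored hM hN hs
  refine le_trans ?_ (Nat.mul_le_mul (List.toFinset_card_le M.states)
    (List.toFinset_card_le N.states))
  rw [← Finset.card_product]
  change (productRun sync M N).val.1.length ≤ _
  rw [← List.toFinset_card_of_nodup hE.nodup]
  refine Finset.card_le_card fun s hs' => ?_
  refine hE.induct (fun s => s ∈ M.states.toFinset ×ˢ N.states.toFinset) ?_ ?_ s
    (List.mem_toFinset.1 hs')
  · simpa using ⟨hM.start_mem, hN.start_mem⟩
  · intro s _ e he
    rw [mem_productSucc hs] at he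
    simpa using ⟨(hM.trans_mem _ he.1).2, (hN.trans_mem _ he.2).2⟩

theorem product_time_le (hM : M.IsDFA) (hN : N.IsDFA)
    (hs : ∀ l m c, sync l m = some c ↔ l = g c ∧ m = h c) {b c : ℕ}
    (hb : ∀ p, (M.out p).length ≤ b) (hc : ∀ p, (N.out p).length ≤ c) :
    (product sync M N).time ≤ (product sync M N).val.states.length * (1 + b * c) := by
  refine (product_explored hM hN hs).time_le (c := b * c) fun s _ => ?_
  exact (List.length_product _ _).trans_le (Nat.mul_le_mul (hb s.1) (hc s.2))

theorem product_trans_length_le (hM : M.IsDFA) (hN : N.IsDFA)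
    (hs : ∀ l m c, sync l m = some c ↔ l = g c ∧ m = h c) {b c : ℕ}
    (hb : ∀ p, (M.out p).length ≤ b) (hc : ∀ p, (N.out p).length ≤ c) :
    (product sync M N).val.trans.length ≤ (product sync M N).val.states.length * (b * c) := by
  refine (product_explored hM hN hs).trans_length_le (c := b * c) fun s _ => ?_
  refine (List.length_filterMap_le _ _).trans ?_
  exact (List.length_product _ _).trans_le (Nat.mul_le_mul (hb s.1) (hc s.2))

end Product

/-! ### Relabelling and projection -/

section Relabel

variable {A C S : Type} {f : A → C} {M : FA A S}

theorem relabel_path {p q : S} {w : List C} :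
    (relabel f M).val.Path p w q ↔ ∃ v, v.map f = w ∧ M.Path p v q := by
  have ht : ∀ p c q, (p, c, q) ∈ (relabel f M).val.trans ↔ ∃ a, f a = c ∧ (p, a, q) ∈ M.trans := by
    intro p c q
    refine List.mem_map.trans ⟨?_, ?_⟩
    · rintro ⟨⟨p, a, q⟩, ht, h⟩
      simp only [Prod.mk.injEq] at h
      obtain ⟨rfl, rfl, rfl⟩ := h
      exact ⟨a, rfl, ht⟩
    · rintro ⟨a, rfl, ht⟩
      exact ⟨_, ht, rfl⟩
  induction w generalizing p with
  | nil => simp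
  | cons c w ih =>
    simp only [FA.path_cons, ht, ih]
    constructor
    · rintro ⟨r, ⟨a, rfl, ha⟩, v, rfl, hv⟩
      exact ⟨a :: v, rfl, r, ha, hv⟩
    · rintro ⟨v, hv, h⟩
      obtain ⟨a, v, rfl, rfl, rfl⟩ := List.map_eq_cons_iff.1 hv
      obtain ⟨r, ha, h⟩ := h
      exact ⟨r, ⟨a, rfl, ha⟩, v, rfl, h⟩

theorem relabel_acc {p : S} {w : List C} :
    (relabel f M).val.Acc p w ↔ ∃ v, v.map f = w ∧ M.Acc p v := by
  simp only [FA.Acc, relabel_path]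
  constructor
  · rintro ⟨q, hq, v, rfl, h⟩
    exact ⟨v, rfl, q, hq, h⟩
  · rintro ⟨v, rfl, q, hq, h⟩
    exact ⟨q, hq, v, rfl, h⟩

end Relabel

/-! ### Subset construction -/

section Determinize

variable {A S : Type} [DecidableEq A] [DecidableEq S]

/-- The set reached from the set `U` on the letter `a`. -/
def FA.image (M : FA A S) (U : Finset S) (a : A) : Finset S :=
  (((M.trans.filter fun t => t.1 ∈ U).filter fun t => t.2.1 = a).map fun t => t.2.2).toFinset

theorem FA.mem_image {M : FA A S} {U : Finset S} {a : A} {q : S} :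
    q ∈ M.image U a ↔ ∃ p ∈ U, (p, a, q) ∈ M.trans := by
  simp only [FA.image, List.mem_toFinset, List.mem_map, List.mem_filter, decide_eq_true_eq,
    Prod.exists]
  constructor
  · rintro ⟨p, _, _, ⟨⟨h, hp⟩, rfl⟩, rfl⟩
    exact ⟨p, hp, h⟩
  · rintro ⟨p, hp, h⟩
    exact ⟨p, _, _, ⟨⟨h, hp⟩, rfl⟩, rfl⟩

/-- The letters read from a set of states in the subset construction, and the sets they lead to. -/
def subsetSucc (letters : List A) (M : FA A S) (U : Finset S) :
    Timed (List (A × Finset S)) := do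
  let followed := M.trans.filter fun t => t.1 ∈ U
  tick followed.length
  let nexts := (letters.map fun a =>
    (a, ((followed.filter fun t => t.2.1 = a).map fun t => t.2.2).toFinset)).filter
      fun aV => aV.2 ≠ ∅
  tick nexts.length
  return nexts

variable {letters : List A} {M : FA A S}

theorem subsetSucc_val (U : Finset S) : (subsetSucc letters M U).val =
    (letters.map fun a => (a, M.image U a)).filter fun aV => aV.2 ≠ ∅ := rfl

theorem mem_subsetSucc (hl : ∀ a, a ∈ letters) {U : Finset S} {e : A × Finset S} :
    e ∈ (subsetSucc letters M U).val ↔ e.2 = M.image U e.1 ∧ e.2.Nonempty := by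
  obtain ⟨a, V⟩ := e
  simp only [subsetSucc_val, List.mem_filter, List.mem_map, hl, true_and, Prod.mk.injEq,
    exists_eq_left, decide_eq_true_eq, Finset.nonempty_iff_ne_empty]
  exact and_congr_left fun _ => eq_comm

theorem subsetSucc_length_le (U : Finset S) :
    (subsetSucc letters M U).val.length ≤ letters.length := by
  rw [subsetSucc_val]
  exact (List.length_filter_le _ _).trans (by simp)

theorem subsetSucc_time_le (U : Finset S) :
    (subsetSucc letters M U).time ≤ M.trans.length + letters.length := by
  have h1 : (subsetSucc letters M U).time = (M.trans.filter fun t => t.1 ∈ U).length +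
    (subsetSucc letters M U).val.length := rfl
  rw [h1]
  exact Nat.add_le_add (List.length_filter_le _ _) (subsetSucc_length_le U)

theorem determinize_explored (hl : ∀ a, a ∈ letters) (hst : M.start ∈ M.states)
    (ht : ∀ t ∈ M.trans, t.1 ∈ M.states ∧ t.2.2 ∈ M.states) :
    Explored (subsetSucc letters M) [{M.start}]
      (explore (subsetSucc letters M) (2 ^ M.states.length) [{M.start}] [{M.start}] []) := by
  refine explore_spec _ _ M.states.toFinset.powerset _ (by simp) (by simpa using hst) ?_ ?_
  · intro U _ e he
    rw [mem_subsetSucc hl] at he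
    rw [Finset.mem_powerset, he.1]
    intro q hq
    obtain ⟨p, -, hp⟩ := FA.mem_image.1 hq
    exact List.mem_toFinset.2 (ht _ hp).2
  · rw [Finset.card_powerset]
    exact Nat.pow_le_pow_right (by norm_num) (List.toFinset_card_le _)

theorem mem_determinize_trans (hl : ∀ a, a ∈ letters) (hst : M.start ∈ M.states)
    (ht : ∀ t ∈ M.trans, t.1 ∈ M.states ∧ t.2.2 ∈ M.states) {U V : Finset S} {a : A} :
    (U, a, V) ∈ (determinize letters M).val.trans ↔
      U ∈ (determinize letters M).val.states ∧ V = M.image U a ∧ V.Nonempty := by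
  have := (determinize_explored hl hst ht).mem_trans (t := (U, a, V))
  rw [mem_subsetSucc hl] at this
  exact this

theorem determinize_isDFA (hl : ∀ a, a ∈ letters) (hst : M.start ∈ M.states)
    (ht : ∀ t ∈ M.trans, t.1 ∈ M.states ∧ t.2.2 ∈ M.states) :
    (determinize letters M).val.IsDFA where
  nodup := (determinize_explored hl hst ht).nodup
  start_mem := (determinize_explored hl hst ht).init_mem _ (List.mem_singleton_self _)
  final_mem q hq := List.mem_of_mem_filter hq
  trans_mem := by
    rintro t h
    have := ((determinize_explored hl hst ht).mem_trans (t := t)).1 h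
    exact ⟨this.1, (determinize_explored hl hst ht).closed _ this.1 _ this.2⟩
  det p a q r hq hr := by
    rw [mem_determinize_trans hl hst ht] at hq hr
    exact hq.2.1.trans hr.2.1.symm

theorem determinize_accessible (hl : ∀ a, a ∈ letters) (hst : M.start ∈ M.states)
    (ht : ∀ t ∈ M.trans, t.1 ∈ M.states ∧ t.2.2 ∈ M.states) :
    (determinize letters M).val.Accessible := by
  intro U hU
  have hE := determinize_explored hl hst ht
  refine (hE.induct (fun U => U ∈ (determinize letters M).val.states ∧
    ∃ w, (determinize letters M).val.Path (determinize letters M).val.start w U) ?_ ?_ U hU).2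
  · intro s hs
    rw [List.mem_singleton] at hs
    subst hs
    exact ⟨hE.init_mem _ (List.mem_singleton_self _), [], rfl⟩
  · rintro U ⟨hU, w, hw⟩ e he
    exact ⟨hE.closed _ hU _ he, w ++ [e.1], FA.path_concat.2 ⟨U, hw,
      (hE.mem_trans (t := (U, e))).2 ⟨hU, he⟩⟩⟩

/-- Empty sets are never created, so a word that leads nowhere in `M` has no path in the subset
automaton; this is the role of the nonemptiness condition. -/
theorem determinize_path (hl : ∀ a, a ∈ letters) (hst : M.start ∈ M.states)
    (ht : ∀ t ∈ M.trans, t.1 ∈ M.states ∧ t.2.2 ∈ M.states) {w : List A} {U : Finset S} :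
    (determinize letters M).val.Path (determinize letters M).val.start w U ↔
      U.Nonempty ∧ ∀ q, q ∈ U ↔ M.Path M.start w q := by
  induction w using List.reverseRecOn generalizing U with
  | nil =>
    change {M.start} = U ↔ _
    constructor
    · rintro rfl
      simp [eq_comm]
    · rintro ⟨-, h⟩
      ext q
      simp [h, eq_comm]
  | append_singleton w a ih =>
    rw [FA.path_concat]
    constructor
    · rintro ⟨V, hV, hVU⟩
      obtain ⟨-, rfl, hne⟩ := (mem_determinize_trans hl hst ht).1 hVU
      refine ⟨hne, fun q => ?_⟩
      rw [FA.mem_image, FA.path_concat]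
      simp only [(ih.1 hV).2]
    · rintro ⟨hne, hU⟩
      classical
      set V := M.states.toFinset.filter fun q => M.Path M.start w q with hV
      have hVm : ∀ q, q ∈ V ↔ M.Path M.start w q := by
        intro q
        simp only [hV, Finset.mem_filter, List.mem_toFinset, and_iff_right_iff_imp]
        exact FA.path_mem ht hst
      have hUV : U = M.image V a := by
        ext q
        rw [hU, FA.mem_image, FA.path_concat]
        simp only [hVm]
      have hVne : V.Nonempty := by
        obtain ⟨q, hq⟩ := hne
        rw [hUV, FA.mem_image] at hq
        obtain ⟨p, hp, -⟩ := hq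
        exact ⟨p, hp⟩
      have hpath := ih.2 ⟨hVne, hVm⟩
      have hD := determinize_isDFA hl hst ht
      exact ⟨V, hpath, (mem_determinize_trans hl hst ht).2
        ⟨FA.path_mem hD.trans_mem hD.start_mem hpath, hUV, hne⟩⟩

theorem determinize_acc (hl : ∀ a, a ∈ letters) (hst : M.start ∈ M.states)
    (ht : ∀ t ∈ M.trans, t.1 ∈ M.states ∧ t.2.2 ∈ M.states) {w : List A} :
    (determinize letters M).val.Acc (determinize letters M).val.start w ↔ M.Acc M.start w := by
  have hf : ∀ U, U ∈ (determinize letters M).val.final ↔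
      U ∈ (determinize letters M).val.states ∧ ∃ q ∈ M.final, q ∈ U := by
    intro q
    refine (List.mem_filter (as := (determinize letters M).val.states)).trans ?_
    simp
  have hD := determinize_isDFA hl hst ht
  simp only [FA.Acc, hf]
  constructor
  · rintro ⟨U, ⟨-, q, hq, hqU⟩, hU⟩
    exact ⟨q, hq, (((determinize_path hl hst ht).1 hU).2 q).1 hqU⟩
  · rintro ⟨q, hq, h⟩
    classical
    have hm : ∀ r, r ∈ (M.states.toFinset.filter fun q => M.Path M.start w q) ↔
        M.Path M.start w r := by
      intro r
      simp only [Finset.mem_filter, List.mem_toFinset, and_iff_right_iff_imp]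
      exact FA.path_mem ht hst
    have hpath := (determinize_path hl hst ht).2 ⟨⟨q, (hm q).2 h⟩, hm⟩
    exact ⟨_, ⟨FA.path_mem hD.trans_mem hD.start_mem hpath, q, hq, (hm q).2 h⟩, hpath⟩

/-- A crude estimate: every set is charged for all transitions of `M`. With O(n^2) sets and O(n^2)
transitions this stays within O(n^4). -/
theorem determinize_time_le (hl : ∀ a, a ∈ letters) (hst : M.start ∈ M.states)
    (ht : ∀ t ∈ M.trans, t.1 ∈ M.states ∧ t.2.2 ∈ M.states) :
    (determinize letters M).time ≤
      (determinize letters M).val.states.length * (1 + (M.trans.length + letters.length)) :=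
  (determinize_explored hl hst ht).time_le fun U _ => subsetSucc_time_le U

theorem determinize_trans_length_le (hl : ∀ a, a ∈ letters) (hst : M.start ∈ M.states)
    (ht : ∀ t ∈ M.trans, t.1 ∈ M.states ∧ t.2.2 ∈ M.states) :
    (determinize letters M).val.trans.length ≤
      (determinize letters M).val.states.length * letters.length :=
  (determinize_explored hl hst ht).trans_length_le fun U _ => subsetSucc_length_le U

end Determinize

/-! ### Removal of states that are not co-accessible -/

section Trim

variable {A S : Type} [DecidableEq S] {M : FA A S}

/-- The transitions followed backwards. -/
def backSucc (M : FA A S) (q : S) : Timed (List (A × S)) := do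
  let back := M.inc q
  tick back.length
  return back.map fun t => (t.2.1, t.1)

theorem mem_backSucc {q : S} {e : A × S} :
    e ∈ (backSucc M q).val ↔ (e.2, e.1, q) ∈ M.trans := by
  obtain ⟨a, p⟩ := e
  simp only [backSucc, Timed.val_bind, Timed.val_pure, List.mem_map, FA.inc, List.mem_filter,
    decide_eq_true_eq, Prod.mk.injEq]
  constructor
  · rintro ⟨t, ⟨ht, rfl⟩, rfl, rfl⟩
    exact ht
  · intro h
    exact ⟨_, ⟨h, rfl⟩, rfl, rfl⟩

/-- The exploration of the co-accessible states. -/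
def backRun (M : FA A S) : Timed (List S × List (S × A × S)) :=
  explore (backSucc M) M.states.length M.final M.final []

theorem trim_explored (hM : M.IsDFA) (hf : M.final.Nodup) :
    Explored (backSucc M) M.final (backRun M) := by
  refine explore_spec _ _ M.states.toFinset _ hf ?_ ?_ (List.toFinset_card_le _)
  · intro s hs
    exact List.mem_toFinset.2 (hM.final_mem s hs)
  · intro s _ e he
    rw [mem_backSucc] at he
    exact List.mem_toFinset.2 (hM.trans_mem _ he).1

theorem mem_backRun (hM : M.IsDFA) (hf : M.final.Nodup) {q : S} :
    q ∈ (backRun M).val.1 ↔ ∃ w, M.Acc q w := by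
  have hE := trim_explored hM hf
  constructor
  · refine hE.induct (fun q => ∃ w, M.Acc q w) (fun s hs => ⟨[], s, hs, rfl⟩) ?_ q
    rintro s ⟨w, hw⟩ ⟨a, p⟩ he
    rw [mem_backSucc] at he
    exact ⟨a :: w, FA.acc_cons.2 ⟨s, he, hw⟩⟩
  · rintro ⟨w, hw⟩
    induction w generalizing q with
    | nil =>
      obtain ⟨r, hr, rfl⟩ := hw
      exact hE.init_mem _ hr
    | cons a w ih =>
      obtain ⟨r, hr, hw⟩ := FA.acc_cons.1 hw
      exact hE.closed r (ih hw) (a, q) (mem_backSucc.2 hr)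

theorem mem_trim_states (hM : M.IsDFA) (hf : M.final.Nodup) {q : S} :
    q ∈ (trim M).val.states ↔ q ∈ M.states ∧ ∃ w, M.Acc q w := by
  rw [← mem_backRun hM hf]
  refine (List.mem_filter (as := M.states)).trans ?_
  rw [decide_eq_true_eq]
  rfl

theorem mem_trim_trans (hM : M.IsDFA) (hf : M.final.Nodup) {t : S × A × S} :
    t ∈ (trim M).val.trans ↔ t ∈ M.trans ∧ ∃ w, M.Acc t.2.2 w := by
  have : t ∈ (trim M).val.trans ↔
      t ∈ M.trans ∧ t.1 ∈ (backRun M).val.1 ∧ t.2.2 ∈ (backRun M).val.1 := by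
    refine (List.mem_filter (as := M.trans)).trans ?_
    rw [decide_eq_true_eq]
    rfl
  rw [this, mem_backRun hM hf, mem_backRun hM hf]
  refine and_congr_right fun ht => ⟨fun h => h.2, fun h => ⟨?_, h⟩⟩
  obtain ⟨w, hw⟩ := h
  exact ⟨t.2.1 :: w, FA.acc_cons.2 ⟨_, ht, hw⟩⟩

theorem trim_acc (hM : M.IsDFA) (hf : M.final.Nodup) {p : S} {w : List A} :
    (trim M).val.Acc p w ↔ M.Acc p w := by
  induction w generalizing p with
  | nil => rfl
  | cons a w ih =>
    simp only [FA.acc_cons, ih, mem_trim_trans hM hf]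
    constructor
    · rintro ⟨r, ⟨h, -⟩, hw⟩
      exact ⟨r, h, hw⟩
    · rintro ⟨r, h, hw⟩
      exact ⟨r, ⟨h, w, hw⟩, hw⟩

theorem trim_path (hM : M.IsDFA) (hf : M.final.Nodup) {p q : S} {w : List A}
    (hq : ∃ v, M.Acc q v) (h : M.Path p w q) : (trim M).val.Path p w q := by
  induction w generalizing p with
  | nil => exact h
  | cons a w ih =>
    obtain ⟨r, hr, h⟩ := h
    obtain ⟨v, hv⟩ := hq
    exact ⟨r, (mem_trim_trans hM hf).2 ⟨hr, w ++ v, FA.acc_append.2 ⟨q, h, hv⟩⟩, ih h⟩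

theorem trim_isDFA (hM : M.IsDFA) (hf : M.final.Nodup) (hs : ∃ w, M.Acc M.start w) :
    (trim M).val.IsDFA where
  nodup := hM.nodup.filter _
  start_mem := (mem_trim_states hM hf).2 ⟨hM.start_mem, hs⟩
  final_mem q hq := (mem_trim_states hM hf).2 ⟨hM.final_mem q hq, [], q, hq, rfl⟩
  trans_mem := by
    rintro ⟨p, a, q⟩ ht
    obtain ⟨ht, w, hw⟩ := (mem_trim_trans hM hf).1 ht
    exact ⟨(mem_trim_states hM hf).2 ⟨(hM.trans_mem _ ht).1, a :: w, FA.acc_cons.2 ⟨_, ht, hw⟩⟩,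
      (mem_trim_states hM hf).2 ⟨(hM.trans_mem _ ht).2, w, hw⟩⟩
  det p a q r hq hr :=
    hM.det p a q r ((mem_trim_trans hM hf).1 hq).1 ((mem_trim_trans hM hf).1 hr).1

theorem trim_accessible (hM : M.IsDFA) (hf : M.final.Nodup) (hacc : M.Accessible) :
    (trim M).val.Accessible := by
  intro q hq
  obtain ⟨hq, hw⟩ := (mem_trim_states hM hf).1 hq
  obtain ⟨v, hv⟩ := hacc q hq
  exact ⟨v, trim_path hM hf hw hv⟩

theorem trim_coaccessible (hM : M.IsDFA) (hf : M.final.Nodup) : (trim M).val.Coaccessible := by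
  intro q hq
  obtain ⟨-, w, hw⟩ := (mem_trim_states hM hf).1 hq
  exact ⟨w, (trim_acc hM hf).2 hw⟩

theorem trim_time_le (hM : M.IsDFA) (hf : M.final.Nodup) :
    (trim M).time ≤ M.states.length * (1 + M.trans.length) + M.trans.length := by
  have hE := trim_explored hM hf
  have h1 : (trim M).time = (backRun M).time + M.trans.length := rfl
  have h2 : (backRun M).val.1.length ≤ M.states.length := by
    rw [← List.toFinset_card_of_nodup hE.nodup]
    refine (Finset.card_le_card fun q hq => ?_).trans (List.toFinset_card_le M.states)
    refine List.mem_toFinset.2 (hE.induct (fun q => q ∈ M.states) hM.final_mem ?_ q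
      (List.mem_toFinset.1 hq))
    intro s _ e he
    exact (hM.trans_mem _ (mem_backSucc.1 he)).1
  rw [h1]
  refine Nat.add_le_add_right ((hE.time_le (c := M.trans.length) fun s _ => ?_).trans
    (Nat.mul_le_mul_right _ h2)) _
  exact List.length_filter_le _ _

end Trim

/-! ### Splitting a block along a set -/

section SplitBlock

variable {S : Type} [DecidableEq S] {X Y Z : Finset S} {p q : S}

/-- The set `X` splits the block `Y`. -/
abbrev Splits (X Y : Finset S) : Prop := Y ∩ X ≠ ∅ ∧ Y \ X ≠ ∅

theorem mem_splitBlock (h : Splits X Y) : Z ∈ splitBlock X Y ↔ Z = Y ∩ X ∨ Z = Y \ X := by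
  rw [splitBlock, if_pos h]
  simp

theorem splitBlock_of_not (h : ¬ Splits X Y) : splitBlock X Y = [Y] := if_neg h

theorem subset_of_mem_splitBlock (h : Z ∈ splitBlock X Y) : Z ⊆ Y := by
  by_cases hs : Splits X Y
  · rcases (mem_splitBlock hs).1 h with rfl | rfl
    · exact Finset.inter_subset_left
    · exact Finset.sdiff_subset
  · rw [splitBlock_of_not hs, List.mem_singleton] at h
    exact h.subset

theorem nonempty_of_mem_splitBlock (hY : Y.Nonempty) (h : Z ∈ splitBlock X Y) : Z.Nonempty := by
  by_cases hs : Splits X Y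
  · rcases (mem_splitBlock hs).1 h with rfl | rfl
    · exact Finset.nonempty_iff_ne_empty.2 hs.1
    · exact Finset.nonempty_iff_ne_empty.2 hs.2
  · rw [splitBlock_of_not hs, List.mem_singleton] at h
    exact h ▸ hY

theorem exists_mem_splitBlock (X : Finset S) (h : q ∈ Y) : ∃ Z ∈ splitBlock X Y, q ∈ Z := by
  by_cases hs : Splits X Y
  · by_cases hq : q ∈ X
    · exact ⟨Y ∩ X, (mem_splitBlock hs).2 (Or.inl rfl), Finset.mem_inter.2 ⟨h, hq⟩⟩
    · exact ⟨Y \ X, (mem_splitBlock hs).2 (Or.inr rfl), Finset.mem_sdiff.2 ⟨h, hq⟩⟩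
  · exact ⟨Y, by simp [splitBlock_of_not hs], h⟩

theorem mem_iff_of_mem_splitBlock (h : Z ∈ splitBlock X Y) (hp : p ∈ Z) (hq : q ∈ Z) :
    p ∈ X ↔ q ∈ X := by
  by_cases hs : Splits X Y
  · rcases (mem_splitBlock hs).1 h with rfl | rfl
    · exact iff_of_true (Finset.mem_inter.1 hp).2 (Finset.mem_inter.1 hq).2
    · exact iff_of_false (Finset.mem_sdiff.1 hp).2 (Finset.mem_sdiff.1 hq).2
  · rw [splitBlock_of_not hs, List.mem_singleton] at h
    subst h
    rw [Splits, not_and_or, not_not, not_not] at hs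
    rcases hs with hs | hs
    · exact iff_of_false (fun hx => Finset.notMem_empty p (hs ▸ Finset.mem_inter.2 ⟨hp, hx⟩))
        (fun hx => Finset.notMem_empty q (hs ▸ Finset.mem_inter.2 ⟨hq, hx⟩))
    · rw [Finset.sdiff_eq_empty_iff_subset] at hs
      exact iff_of_true (hs hp) (hs hq)

theorem eq_of_mem_splitBlock {Z' : Finset S} (h : Z ∈ splitBlock X Y) (h' : Z' ∈ splitBlock X Y)
    (hp : p ∈ Z) (hp' : p ∈ Z') : Z = Z' := by
  by_cases hs : Splits X Y
  · rcases (mem_splitBlock hs).1 h with rfl | rfl <;>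
      rcases (mem_splitBlock hs).1 h' with rfl | rfl
    · rfl
    · exact absurd (Finset.mem_inter.1 hp).2 (Finset.mem_sdiff.1 hp').2
    · exact absurd (Finset.mem_inter.1 hp').2 (Finset.mem_sdiff.1 hp).2
    · rfl
  · rw [splitBlock_of_not hs, List.mem_singleton] at h h'
    rw [h, h']

theorem splitBlock_nodup : (splitBlock X Y).Nodup := by
  by_cases hs : Splits X Y
  · rw [splitBlock, if_pos hs]
    refine List.nodup_cons.2 ⟨fun h => ?_, List.nodup_singleton _⟩
    rw [List.mem_singleton] at h
    obtain ⟨x, hx⟩ := Finset.nonempty_iff_ne_empty.2 hs.1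
    have hx' := h ▸ hx
    exact (Finset.mem_sdiff.1 hx').2 (Finset.mem_inter.1 hx).2
  · rw [splitBlock_of_not hs]
    exact List.nodup_singleton _

theorem splitBlock_length : (splitBlock X Y).length = if Splits X Y then 2 else 1 := by
  rw [splitBlock]
  split_ifs <;> rfl

theorem smallerHalf_mem (h : Splits X Y) : smallerHalf X Y ∈ splitBlock X Y := by
  rw [mem_splitBlock h, smallerHalf]
  split_ifs
  · exact Or.inl rfl
  · exact Or.inr rfl

theorem exists_half_of_split {Y Z : Finset S} (hs : Splits X Y) (hZ : Z ∈ splitBlock X Y) :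
    ∃ Z' ∈ splitBlock X Y, Y = Z ∪ Z' ∧ Disjoint Z Z' ∧
      ∀ V ∈ splitBlock X Y, V = Z ∨ V = Z' := by
  have hd : Disjoint (Y ∩ X) (Y \ X) :=
    Finset.disjoint_left.2 fun x hx hx' => (Finset.mem_sdiff.1 hx').2 (Finset.mem_inter.1 hx).2
  have hu : Y = Y ∩ X ∪ Y \ X := by
    ext x
    simp only [Finset.mem_union, Finset.mem_inter, Finset.mem_sdiff]
    tauto
  rcases (mem_splitBlock hs).1 hZ with rfl | rfl
  · exact ⟨Y \ X, (mem_splitBlock hs).2 (Or.inr rfl), hu, hd, fun V hV => (mem_splitBlock hs).1 hV⟩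
  · exact ⟨Y ∩ X, (mem_splitBlock hs).2 (Or.inl rfl), by rw [Finset.union_comm]; exact hu,
      hd.symm, fun V hV => ((mem_splitBlock hs).1 hV).symm⟩

end SplitBlock

/-! ### Hopcroft's partition refinement -/

section Refine

variable {A S : Type}

/-- The state `p` has a transition on the letter `a` into the set `V`. -/
def FA.Pre (M : FA A S) (V : Finset S) (a : A) (p : S) : Prop := ∃ q ∈ V, (p, a, q) ∈ M.trans

/-- The invariant of partition refinement: `P` is a partition of the states that is finer than the
one into accepting and non-accepting states and coarser than equality of languages, and any
violation of stability is detected by a waiting splitter. -/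
structure RefineInv (M : FA A S) (P : List (Finset S)) (W : List (Finset S × A)) : Prop where
  nodup : P.Nodup
  nonempty : ∀ Y ∈ P, Y.Nonempty
  disjoint : ∀ Y ∈ P, ∀ Z ∈ P, ∀ p, p ∈ Y → p ∈ Z → Y = Z
  cover : ∀ q, q ∈ M.states ↔ ∃ Y ∈ P, q ∈ Y
  waiting_nodup : W.Nodup
  waiting_mem : ∀ v ∈ W, v.1 ∈ P
  final : ∀ Y ∈ P, ∀ p ∈ Y, ∀ q ∈ Y, p ∈ M.final ↔ q ∈ M.final
  coarse : ∀ Y ∈ P, ∀ p ∈ M.states, ∀ q ∈ M.states, (∀ w, M.Acc p w ↔ M.Acc q w) →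
    p ∈ Y → q ∈ Y
  stable : ∀ Y ∈ P, ∀ p ∈ Y, ∀ q ∈ Y, ∀ a, ∀ Z ∈ P, (M.Pre Z a p ↔ M.Pre Z a q) ∨
    ∃ V, (V, a) ∈ W ∧ ¬ (M.Pre V a p ↔ M.Pre V a q)

variable {M : FA A S} {P : List (Finset S)} {W : List (Finset S × A)}

theorem RefineInv.length_le [DecidableEq S] (h : RefineInv M P W) :
    P.length ≤ M.states.length := by
  have hne : ∀ Y : {Y // Y ∈ P}, ∃ q, q ∈ Y.1 := fun Y => h.nonempty Y.1 Y.2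
  choose f hf using hne
  have h1 : (P.attach.map f).Nodup := by
    refine List.Nodup.map ?_ (List.nodup_attach.2 h.nodup)
    intro Y Z hYZ
    exact Subtype.ext (h.disjoint Y.1 Y.2 Z.1 Z.2 (f Y) (hf Y) (hYZ ▸ hf Z))
  have h2 : P.attach.map f ⊆ M.states := by
    intro q hq
    obtain ⟨Y, -, rfl⟩ := List.mem_map.1 hq
    exact (h.cover _).2 ⟨Y.1, Y.2, hf Y⟩
  simpa using (h1.subperm h2).length_le

theorem RefineInv.tail {v : Finset S × A} (h : RefineInv M P (v :: W)) :
    W.Nodup ∧ v ∉ W ∧ ∀ v ∈ W, v.1 ∈ P :=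
  ⟨(List.nodup_cons.1 h.waiting_nodup).2, (List.nodup_cons.1 h.waiting_nodup).1,
    fun v hv => h.waiting_mem v (List.mem_cons_of_mem _ hv)⟩

theorem pre_disjoint (hM : M.IsDFA) {V V' : Finset S} {a : A} {p : S} (hd : Disjoint V V')
    (h : M.Pre V a p) : ¬ M.Pre V' a p := by
  rintro ⟨r, hr, hpr⟩
  obtain ⟨q, hq, hpq⟩ := h
  obtain rfl := hM.det _ _ _ _ hpq hpr
  exact Finset.disjoint_left.1 hd hq hr

/-- This is why one half is enough in Hopcroft's algorithm. If two states agree on entering a block,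
and determinism makes entering its two halves exclusive, then they differ on one half exactly when
they differ on the other. -/
theorem not_iff_of_exclusive {p p' p'' q q' q'' : Prop} (hp : p ↔ p' ∨ p'') (hq : q ↔ q' ∨ q'')
    (hp' : p' → ¬ p'') (hq' : q' → ¬ q'') (h : p ↔ q) (h' : ¬ (p' ↔ q')) : ¬ (p'' ↔ q'') := by
  tauto

variable [DecidableEq S]

theorem pre_union {V V' V'' : Finset S} {a : A} {p : S} (h : V = V' ∪ V'') :
    M.Pre V a p ↔ M.Pre V' a p ∨ M.Pre V'' a p := by
  subst h
  simp only [FA.Pre, Finset.mem_union, or_and_right, exists_or]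

/-- The splitters in the list after it is updated for a split along `X`. -/
def waiting (X : Finset S) (W : List (Finset S × A)) : List (Finset S × A) :=
  W.flatMap fun Yc => (splitBlock X Yc.1).map fun Z => (Z, Yc.2)

variable {X : Finset S}

theorem mem_waiting {v : Finset S × A} :
    v ∈ waiting X W ↔ ∃ Y, (Y, v.2) ∈ W ∧ v.1 ∈ splitBlock X Y := by
  obtain ⟨Z, c⟩ := v
  simp only [waiting, List.mem_flatMap, List.mem_map, Prod.exists, Prod.mk.injEq]
  constructor
  · rintro ⟨Y, _, h, _, hZ, rfl, rfl⟩
    exact ⟨Y, h, hZ⟩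
  · rintro ⟨Y, h, hZ⟩
    exact ⟨Y, _, h, _, hZ, rfl, rfl⟩

theorem sum_map_splitBlock_length {α : Type} (l : List α) (f : α → Finset S) :
    (l.map fun x => (splitBlock X (f x)).length).sum =
      l.length + (l.filter fun x => Splits X (f x)).length := by
  induction l with
  | nil => rfl
  | cons x l ih =>
    rw [List.map_cons, List.sum_cons, ih, splitBlock_length, List.length_cons, List.filter_cons]
    by_cases h : Splits X (f x)
    · rw [if_pos h, if_pos (decide_eq_true h), List.length_cons]
      omega
    · rw [if_neg h, if_neg (by simpa using h)]
      omega

theorem waiting_length : (waiting X W).length =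
    W.length + (W.filter fun v => Splits X v.1).length := by
  rw [waiting, List.length_flatMap, ← sum_map_splitBlock_length]
  simp

variable [DecidableEq A] {letters : List A}

/-- The states with a transition on the letter `a` into the set `B`. -/
def preSet (M : FA A S) (B : Finset S) (a : A) : Finset S :=
  ((M.trans.filter fun t => t.2.1 = a ∧ t.2.2 ∈ B).map fun t => t.1).toFinset

theorem mem_preSet {B : Finset S} {a : A} {p : S} : p ∈ preSet M B a ↔ M.Pre B a p := by
  simp only [preSet, List.mem_toFinset, List.mem_map, List.mem_filter, decide_eq_true_eq, FA.Pre,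
    Prod.exists]
  constructor
  · rintro ⟨p, _, q, ⟨h, rfl, hq⟩, rfl⟩
    exact ⟨q, hq, h⟩
  · rintro ⟨q, hq, h⟩
    exact ⟨_, _, q, ⟨h, rfl, hq⟩, rfl⟩

/-- The splitters added for a split along `X`. -/
def added (letters : List A) (X : Finset S) (P : List (Finset S)) (W : List (Finset S × A)) :
    List (Finset S × A) :=
  P.flatMap fun Y =>
    if Y ∩ X ≠ ∅ ∧ Y \ X ≠ ∅ then
      (letters.filter fun c => (Y, c) ∉ W).map fun c => (smallerHalf X Y, c)
    else []

theorem mem_added {v : Finset S × A} :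
    v ∈ added letters X P W ↔
      ∃ Y ∈ P, Splits X Y ∧ v.2 ∈ letters ∧ (Y, v.2) ∉ W ∧ v.1 = smallerHalf X Y := by
  obtain ⟨Z, c⟩ := v
  simp only [added, List.mem_flatMap]
  refine exists_congr fun Y => and_congr_right fun _ => ?_
  by_cases hs : Splits X Y
  · rw [if_pos hs]
    simp only [List.mem_map, List.mem_filter, decide_eq_true_eq, Prod.mk.injEq]
    constructor
    · rintro ⟨_, ⟨h1, h2⟩, rfl, rfl⟩
      exact ⟨hs, h1, h2, rfl⟩
    · rintro ⟨-, h1, h2, rfl⟩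
      exact ⟨_, ⟨h1, h2⟩, rfl, rfl⟩
  · rw [if_neg hs]
    simp [hs]

theorem added_length_add :
    (added letters X P W).length + (P.flatMap fun Y => if Splits X Y then
      (letters.filter fun c => (Y, c) ∈ W).map fun c => (Y, c) else []).length =
      letters.length * (P.filter fun Y => Splits X Y).length := by
  have hlen : ∀ Y, (letters.filter fun c => (Y, c) ∉ W).length +
      (letters.filter fun c => (Y, c) ∈ W).length = letters.length := by
    intro Y
    generalize letters = l
    induction l with
    | nil => rfl
    | cons c l ih =>
      simp only [List.filter_cons, List.length_cons]
      by_cases h : (Y, c) ∈ W <;> simp [h] <;> simp at ih <;> omega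
  rw [added]
  induction P with
  | nil => simp
  | cons Y P ih =>
    rw [List.flatMap_cons, List.flatMap_cons, List.length_append, List.length_append,
      List.filter_cons]
    by_cases h : Splits X Y
    · have := hlen Y
      rw [if_pos h, if_pos h, if_pos (decide_eq_true h), List.length_map, List.length_map,
        List.length_cons, Nat.mul_succ]
      omega
    · rw [if_neg h, if_neg h, if_neg (by simpa using h)]
      simpa using ih

/-- Each split block adds one splitter per letter: for a waiting pair two halves replace one block,
and for any other pair one half is added. -/
theorem waiting_added_length_le (hl : ∀ a, a ∈ letters) (hW : W.Nodup) (hWP : ∀ v ∈ W, v.1 ∈ P) :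
    (waiting X W ++ added letters X P W).length ≤
      W.length + letters.length * (P.filter fun Y => Splits X Y).length := by
  rw [List.length_append, waiting_length, ← added_length_add (W := W)]
  have : (W.filter fun v => Splits X v.1).length ≤ (P.flatMap fun Y => if Splits X Y then
      (letters.filter fun c => (Y, c) ∈ W).map fun c => (Y, c) else []).length := by
    refine ((hW.filter _).subperm ?_).length_le
    rintro ⟨Y, c⟩ hv
    rw [List.mem_filter, decide_eq_true_eq] at hv
    refine List.mem_flatMap.2 ⟨Y, hWP _ hv.1, ?_⟩
    rw [if_pos hv.2]
    exact List.mem_map.2 ⟨c, List.mem_filter.2 ⟨hl c, decide_eq_true hv.1⟩, rfl⟩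
  omega

theorem RefineInv.waiting_added_nodup (hnl : letters.Nodup) {v : Finset S × A}
    (h : RefineInv M P (v :: W)) : (waiting X W ++ added letters X P W).Nodup := by
  obtain ⟨hW, -, hWP⟩ := h.tail
  have key : ∀ Y ∈ P, ∀ Y' ∈ P, ∀ Z, Z ∈ splitBlock X Y → Z ∈ splitBlock X Y' → Y = Y' := by
    intro Y hY Y' hY' Z hZ hZ'
    obtain ⟨x, hx⟩ := nonempty_of_mem_splitBlock (h.nonempty Y hY) hZ
    exact h.disjoint Y hY Y' hY' x (subset_of_mem_splitBlock hZ hx)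
      (subset_of_mem_splitBlock hZ' hx)
  refine List.Nodup.append ?_ ?_ ?_
  · refine List.nodup_flatMap.2 ⟨fun v _ => ?_, ?_⟩
    · exact splitBlock_nodup.map fun Y Z hYZ => (Prod.mk.injEq _ _ _ _ ▸ hYZ).1
    · refine hW.pairwise_of_forall_ne ?_
      rintro ⟨Y, c⟩ hv ⟨Y', c'⟩ hv' hne ⟨Z, d⟩ hZ hZ'
      simp only [List.mem_map, Prod.mk.injEq] at hZ hZ'
      obtain ⟨_, hZ, rfl, rfl⟩ := hZ
      obtain ⟨_, hZ', rfl, rfl⟩ := hZ'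
      exact hne (by rw [key Y (hWP _ hv) Y' (hWP _ hv') _ hZ hZ'])
  · refine List.nodup_flatMap.2 ⟨fun Y _ => ?_, ?_⟩
    · split_ifs
      · exact (hnl.filter _).map fun c d hcd => (Prod.mk.injEq _ _ _ _ ▸ hcd).2
      · exact List.nodup_nil
    · refine h.nodup.pairwise_of_forall_ne ?_
      rintro Y hY Y' hY' hne ⟨Z, d⟩ hZ hZ'
      refine hne (key Y hY Y' hY' Z ?_ ?_)
      · beta_reduce at hZ
        split_ifs at hZ with hs
        · obtain ⟨c, -, hc⟩ := List.mem_map.1 hZ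
          exact (Prod.mk.injEq _ _ _ _ ▸ hc).1 ▸ smallerHalf_mem hs
        · exact absurd hZ List.not_mem_nil
      · beta_reduce at hZ'
        split_ifs at hZ' with hs
        · obtain ⟨c, -, hc⟩ := List.mem_map.1 hZ'
          exact (Prod.mk.injEq _ _ _ _ ▸ hc).1 ▸ smallerHalf_mem hs
        · exact absurd hZ' List.not_mem_nil
  · intro v hv hv'
    obtain ⟨Y, hY, hZ⟩ := mem_waiting.1 hv
    obtain ⟨Y', hY', hs, -, hYW, hv'⟩ := mem_added.1 hv'
    obtain rfl := key Y (hWP _ hY) Y' hY' v.1 hZ (hv' ▸ smallerHalf_mem hs)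
    exact hYW hY

/-- The delicate clause is `stable`. A disagreement on a new block is inherited either from its
parent or from the split of the parent, and in both cases a splitter in the new list detects it.
Which half is added plays no role here. -/
theorem RefineInv.step (hM : M.IsDFA) (hco : M.Coaccessible) (hl : ∀ a, a ∈ letters)
    (hnl : letters.Nodup) {B : Finset S} {b : A} (h : RefineInv M P ((B, b) :: W)) :
    RefineInv M (P.flatMap (splitBlock (preSet M B b)))
      (waiting (preSet M B b) W ++ added letters (preSet M B b) P W) := by
  obtain ⟨hW, hBW, hWP⟩ := h.tail
  set X := preSet M B b with hX
  have hP : ∀ Z, Z ∈ P.flatMap (splitBlock X) ↔ ∃ Y ∈ P, Z ∈ splitBlock X Y :=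
    fun Z => List.mem_flatMap
  refine ⟨?_, ?_, ?_, ?_, h.waiting_added_nodup hnl, ?_, ?_, ?_, ?_⟩
  · refine List.nodup_flatMap.2 ⟨fun Y _ => splitBlock_nodup, h.nodup.pairwise_of_forall_ne ?_⟩
    intro Y hY Y' hY' hne Z hZ hZ'
    obtain ⟨x, hx⟩ := nonempty_of_mem_splitBlock (h.nonempty Y hY) hZ
    exact hne (h.disjoint Y hY Y' hY' x (subset_of_mem_splitBlock hZ hx)
      (subset_of_mem_splitBlock hZ' hx))
  · intro Z hZ
    obtain ⟨Y, hY, hZ⟩ := (hP Z).1 hZ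
    exact nonempty_of_mem_splitBlock (h.nonempty Y hY) hZ
  · intro Z hZ Z' hZ' p hp hp'
    obtain ⟨Y, hY, hZ⟩ := (hP Z).1 hZ
    obtain ⟨Y', hY', hZ'⟩ := (hP Z').1 hZ'
    obtain rfl := h.disjoint Y hY Y' hY' p (subset_of_mem_splitBlock hZ hp)
      (subset_of_mem_splitBlock hZ' hp')
    exact eq_of_mem_splitBlock hZ hZ' hp hp'
  · intro q
    rw [h.cover]
    constructor
    · rintro ⟨Y, hY, hq⟩
      obtain ⟨Z, hZ, hq⟩ := exists_mem_splitBlock X hq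
      exact ⟨Z, (hP Z).2 ⟨Y, hY, hZ⟩, hq⟩
    · rintro ⟨Z, hZ, hq⟩
      obtain ⟨Y, hY, hZ⟩ := (hP Z).1 hZ
      exact ⟨Y, hY, subset_of_mem_splitBlock hZ hq⟩
  · intro v hv
    rw [hP]
    rcases List.mem_append.1 hv with hv | hv
    · obtain ⟨Y, hY, hZ⟩ := mem_waiting.1 hv
      exact ⟨Y, hWP _ hY, hZ⟩
    · obtain ⟨Y, hY, hs, -, -, hv⟩ := mem_added.1 hv
      exact ⟨Y, hY, hv ▸ smallerHalf_mem hs⟩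
  · intro Z hZ p hp q hq
    obtain ⟨Y, hY, hZ⟩ := (hP Z).1 hZ
    exact h.final Y hY p (subset_of_mem_splitBlock hZ hp) q (subset_of_mem_splitBlock hZ hq)
  · have hXc : ∀ p ∈ M.states, ∀ q ∈ M.states, (∀ w, M.Acc p w ↔ M.Acc q w) → p ∈ X → q ∈ X := by
      intro p hp q hq hpq hpX
      rw [hX, mem_preSet] at hpX ⊢
      obtain ⟨p', hp', ht⟩ := hpX
      obtain ⟨w, hw⟩ := hco p' (hM.trans_mem _ ht).2
      obtain ⟨q', ht', -⟩ := FA.acc_cons.1 ((hpq (b :: w)).1 (FA.acc_cons.2 ⟨p', ht, hw⟩))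
      refine ⟨q', h.coarse B (h.waiting_mem _ List.mem_cons_self) p' (hM.trans_mem _ ht).2 q'
        (hM.trans_mem _ ht').2 (fun w => ?_) hp', ht'⟩
      rw [← hM.acc_append (v := [b]) (p := p) ⟨p', ht, rfl⟩,
        ← hM.acc_append (v := [b]) (p := q) ⟨q', ht', rfl⟩]
      exact hpq _
    intro Z hZ p hp q hq hpq hpZ
    obtain ⟨Y, hY, hZ⟩ := (hP Z).1 hZ
    have hqY := h.coarse Y hY p hp q hq hpq (subset_of_mem_splitBlock hZ hpZ)
    by_cases hs : Splits X Y
    · rcases (mem_splitBlock hs).1 hZ with rfl | rfl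
      · exact Finset.mem_inter.2 ⟨hqY, hXc p hp q hq hpq (Finset.mem_inter.1 hpZ).2⟩
      · exact Finset.mem_sdiff.2 ⟨hqY, fun hqX => (Finset.mem_sdiff.1 hpZ).2
          (hXc q hq p hp (fun w => (hpq w).symm) hqX)⟩
    · rw [splitBlock_of_not hs, List.mem_singleton] at hZ
      exact hZ ▸ hqY
  · intro Y' hY' p hp q hq a Z' hZ'
    obtain ⟨Y, hY, hYs⟩ := (hP Y').1 hY'
    obtain ⟨Z, hZ, hZs⟩ := (hP Z').1 hZ'
    rw [or_iff_not_imp_left]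
    intro hne
    -- If `p` and `q` agree on the parent block `Z`, then `Z` was split. Either `Z'` itself is now
    -- waiting, or the smaller half was added, and by determinism it detects the disagreement
    -- whichever half it is.
    by_cases hZiff : M.Pre Z a p ↔ M.Pre Z a q
    · by_cases hs : Splits X Z
      · by_cases hZW : (Z, a) ∈ W
        · exact ⟨Z', List.mem_append_left _ (mem_waiting.2 ⟨Z, hZW, hZs⟩), hne⟩
        · refine ⟨smallerHalf X Z, List.mem_append_right _
            (mem_added.2 ⟨Z, hZ, hs, hl a, hZW, rfl⟩), ?_⟩
          obtain ⟨Z'', -, hu, hd, hor⟩ := exists_half_of_split hs hZs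
          rcases hor _ (smallerHalf_mem hs) with e | e
          · rwa [e]
          · rw [e]
            exact not_iff_of_exclusive (pre_union hu) (pre_union hu) (pre_disjoint hM hd)
              (pre_disjoint hM hd) hZiff hne
      · rw [splitBlock_of_not hs, List.mem_singleton] at hZs
        exact absurd (hZs ▸ hZiff) hne
    -- If they disagree on `Z`, an old splitter `V` tells them apart. It is not the one just
    -- processed, since `p` and `q` lie on the same side of `X`; so `V` survives in the list, whole
    -- or through its halves, one of which still tells them apart.
    · obtain ⟨V, hV, hVne⟩ := (h.stable Y hY p (subset_of_mem_splitBlock hYs hp) q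
        (subset_of_mem_splitBlock hYs hq) a Z hZ).resolve_left hZiff
      rcases List.mem_cons.1 hV with hV | hV
      · obtain ⟨rfl, rfl⟩ := Prod.mk.injEq _ _ _ _ ▸ hV
        have := mem_iff_of_mem_splitBlock hYs hp hq
        rw [hX, mem_preSet, mem_preSet] at this
        exact absurd this hVne
      · by_cases hs : Splits X V
        · obtain ⟨V', hV', hu, -, -⟩ := exists_half_of_split hs
            ((mem_splitBlock hs).2 (Or.inl rfl))
          by_cases hiff : M.Pre (V ∩ X) a p ↔ M.Pre (V ∩ X) a q
          · refine ⟨V', List.mem_append_left _ (mem_waiting.2 ⟨V, hV, hV'⟩), fun hiff' => hVne ?_⟩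
            rw [pre_union hu, pre_union hu, hiff, hiff']
          · exact ⟨V ∩ X, List.mem_append_left _
              (mem_waiting.2 ⟨V, hV, (mem_splitBlock hs).2 (Or.inl rfl)⟩), hiff⟩
        · refine ⟨V, List.mem_append_left _ (mem_waiting.2 ⟨V, hV, ?_⟩), hVne⟩
          rw [splitBlock_of_not hs]
          exact List.mem_singleton_self _

theorem refine_cons (k : ℕ) (B : Finset S) (b : A) :
    refine letters M (k + 1) P ((B, b) :: W) = (do
      tick (1 + (M.trans.filter fun t => t.2.1 = b ∧ t.2.2 ∈ B).length)
      refine letters M k (P.flatMap (splitBlock (preSet M B b)))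
        (waiting (preSet M B b) W ++ added letters (preSet M B b) P W)) := rfl

/-- The potential is the number of waiting splitters plus the number of letters times the number of
splits still possible. A split moves potential from the second term to the first without increasing
the sum, and processing a splitter removes one; `RefineInv.length_le` keeps the second term
nonnegative. -/
theorem refine_spec (hM : M.IsDFA) (hco : M.Coaccessible) (hl : ∀ a, a ∈ letters)
    (hnl : letters.Nodup) (k : ℕ) (h : RefineInv M P W)
    (hk : W.length + letters.length * M.states.length ≤ k + letters.length * P.length) :
    RefineInv M (refine letters M k P W).val [] ∧
      (refine letters M k P W).time ≤ k * (1 + M.trans.length) := by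
  induction k generalizing P W with
  | zero =>
    have := Nat.mul_le_mul_left letters.length h.length_le
    obtain rfl : W = [] := List.length_eq_zero_iff.1 (by omega)
    exact ⟨h, Nat.zero_le _⟩
  | succ k ih =>
    match W, h, hk with
    | [], h, hk => exact ⟨h, Nat.zero_le _⟩
    | (B, b) :: W, h, hk =>
      obtain ⟨hW, -, hWP⟩ := h.tail
      rw [refine_cons]
      simp only [Timed.val_bind, Timed.time_bind, tick_time]
      have hlen := waiting_added_length_le (X := preSet M B b) hl hW hWP
      have hP : (P.flatMap (splitBlock (preSet M B b))).length =
          P.length + (P.filter fun Y => Splits (preSet M B b) Y).length := by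
        rw [List.length_flatMap]
        exact sum_map_splitBlock_length P id
      obtain ⟨h1, h2⟩ := ih (h.step hM hco hl hnl) (by
        rw [hP, Nat.mul_add]
        rw [List.length_cons] at hk
        omega)
      refine ⟨h1, ?_⟩
      have h3 : (M.trans.filter fun t => t.2.1 = b ∧ t.2.2 ∈ B).length ≤ M.trans.length :=
        List.length_filter_le _ _
      rw [Nat.succ_mul]
      omega

end Refine

/-! ### Minimization: initial partition and quotient -/

section Minimize

/-- A trim deterministic automaton whose states accept different languages. -/
structure FA.IsMinimal {A S : Type} (M : FA A S) : Prop extends M.IsDFA where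
  accessible : M.Accessible
  coaccessible : M.Coaccessible
  distinct : ∀ p ∈ M.states, ∀ q ∈ M.states, (∀ w, M.Acc p w ↔ M.Acc q w) → p = q
  trans_nodup : M.trans.Nodup

variable {A S : Type} {M : FA A S} {P : List (Finset S)}

theorem RefineInv.acc_iff (h : RefineInv M P []) {Y : Finset S} (hY : Y ∈ P) {p q : S}
    (hp : p ∈ Y) (hq : q ∈ Y) (hM : M.IsDFA) (w : List A) : M.Acc p w → M.Acc q w := by
  induction w generalizing Y p q with
  | nil =>
    rintro ⟨r, hr, rfl⟩
    exact ⟨q, (h.final Y hY _ hp q hq).1 hr, rfl⟩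
  | cons a w ih =>
    rw [FA.acc_cons, FA.acc_cons]
    rintro ⟨p', ht, hw⟩
    obtain ⟨Z, hZ, hp'⟩ := (h.cover p').1 (hM.trans_mem _ ht).2
    obtain ⟨q', hq', ht'⟩ : M.Pre Z a q :=
      ((h.stable Y hY p hp q hq a Z hZ).resolve_right (by simp)).1 ⟨p', hp', ht⟩
    exact ⟨q', ht', ih hZ hp' hq' hw⟩

variable [DecidableEq S]

/-- The nonempty ones among the sets of accepting and of non-accepting states. -/
def initialBlocks (M : FA A S) : List (Finset S) :=
  [(M.states.filter fun q => q ∈ M.final).toFinset,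
    (M.states.filter fun q => q ∉ M.final).toFinset].filter fun Y => Y ≠ ∅

/-- The number of the block of a state. -/
def blockIdx (P : List (Finset S)) (q : S) : ℕ := P.findIdx fun Y => q ∈ Y

theorem mem_initialBlocks {Y : Finset S} (h : Y ∈ initialBlocks M) : Y.Nonempty ∧
    ((∀ q, q ∈ Y ↔ q ∈ M.states ∧ q ∈ M.final) ∨ ∀ q, q ∈ Y ↔ q ∈ M.states ∧ q ∉ M.final) := by
  rw [initialBlocks, List.mem_filter, decide_eq_true_eq] at h
  refine ⟨Finset.nonempty_iff_ne_empty.2 h.2, ?_⟩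
  rcases List.mem_cons.1 h.1 with rfl | h
  · exact Or.inl fun q => by simp
  · rw [List.mem_singleton] at h
    exact Or.inr fun q => by simp [h]

theorem getElem_blockIdx {q : S} (h : ∃ Y ∈ P, q ∈ Y) :
    ∃ hi : blockIdx P q < P.length, q ∈ P[blockIdx P q] := by
  have hi : blockIdx P q < P.length := by
    rw [blockIdx, List.findIdx_lt_length]
    obtain ⟨Y, hY, hq⟩ := h
    exact ⟨Y, hY, decide_eq_true hq⟩
  exact ⟨hi, of_decide_eq_true (List.findIdx_getElem (p := fun Y => decide (q ∈ Y)) (w := hi))⟩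

theorem RefineInv.blockIdx_eq_iff (h : RefineInv M P []) (hM : M.IsDFA) {p q : S}
    (hp : p ∈ M.states) (hq : q ∈ M.states) :
    blockIdx P p = blockIdx P q ↔ ∀ w, M.Acc p w ↔ M.Acc q w := by
  obtain ⟨hi, hpi⟩ := getElem_blockIdx ((h.cover p).1 hp)
  obtain ⟨hj, hqj⟩ := getElem_blockIdx ((h.cover q).1 hq)
  constructor
  · intro e w
    have hqi : q ∈ P[blockIdx P p] := by simpa only [e] using hqj
    exact ⟨h.acc_iff (List.getElem_mem hi) hpi hqi hM w,
      h.acc_iff (List.getElem_mem hi) hqi hpi hM w⟩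
  · intro hpq
    have hqi := h.coarse _ (List.getElem_mem hi) p hp q hq hpq hpi
    exact (h.nodup.getElem_inj_iff).1
      (h.disjoint _ (List.getElem_mem hi) _ (List.getElem_mem hj) q hqi hqj)

theorem RefineInv.exists_blockIdx (h : RefineInv M P []) {i : ℕ} (hi : i < P.length) :
    ∃ q ∈ M.states, blockIdx P q = i := by
  obtain ⟨q, hq⟩ := h.nonempty _ (List.getElem_mem hi)
  have hqM := (h.cover q).2 ⟨_, List.getElem_mem hi, hq⟩
  obtain ⟨hj, hqj⟩ := getElem_blockIdx ((h.cover q).1 hqM)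
  exact ⟨q, hqM, (h.nodup.getElem_inj_iff).1
    (h.disjoint _ (List.getElem_mem hj) _ (List.getElem_mem hi) q hqj hq)⟩

variable {letters : List A}

theorem initialBlocks_inv (hl : ∀ a, a ∈ letters) (hnl : letters.Nodup) :
    RefineInv M (initialBlocks M) (initialBlocks M ×ˢ letters) := by
  have hdisj : ∀ Y ∈ initialBlocks M, ∀ Z ∈ initialBlocks M, ∀ p, p ∈ Y → p ∈ Z → Y = Z := by
    intro Y hY Z hZ p hp hp'
    ext q
    rcases (mem_initialBlocks hY).2 with h | h <;> rcases (mem_initialBlocks hZ).2 with h' | h'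
    · rw [h, h']
    · exact absurd ((h p).1 hp).2 ((h' p).1 hp').2
    · exact absurd ((h' p).1 hp').2 ((h p).1 hp).2
    · rw [h, h']
  have hnd : (initialBlocks M).Nodup := by
    set F := (M.states.filter fun q => q ∈ M.final).toFinset with hF
    set G := (M.states.filter fun q => q ∉ M.final).toFinset with hG
    by_cases hne : F = ∅
    · have : initialBlocks M = [G].filter fun Y => Y ≠ ∅ := by
        rw [initialBlocks, ← hF, ← hG, List.filter_cons, if_neg (by simpa using hne)]
      rw [this]
      exact (List.nodup_singleton G).filter _
    · refine List.Nodup.filter _ (List.nodup_cons.2 ⟨fun h => hne ?_, List.nodup_singleton G⟩)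
      rw [List.mem_singleton] at h
      refine Finset.eq_empty_of_forall_notMem fun q hq => ?_
      have h1 : q ∈ M.final := by
        rw [hF, List.mem_toFinset, List.mem_filter, decide_eq_true_eq] at hq
        exact hq.2
      have h2 : q ∉ M.final := by
        rw [hF, h, List.mem_toFinset, List.mem_filter, decide_eq_true_eq] at hq
        exact hq.2
      exact h2 h1
  refine ⟨hnd, fun Y hY => (mem_initialBlocks hY).1, hdisj, ?_, hnd.product hnl, ?_, ?_, ?_, ?_⟩
  · intro q
    constructor
    · intro hq
      have key : ∀ Y : Finset S, q ∈ Y →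
          Y ∈ [(M.states.filter fun q => q ∈ M.final).toFinset,
            (M.states.filter fun q => q ∉ M.final).toFinset] → Y ∈ initialBlocks M := by
        intro Y hqY hY
        exact List.mem_filter.2 ⟨hY, decide_eq_true (Finset.nonempty_iff_ne_empty.1 ⟨q, hqY⟩)⟩
      by_cases hf : q ∈ M.final
      · exact ⟨_, key (M.states.filter fun q => q ∈ M.final).toFinset (by simp [hq, hf])
          (by simp), by simp [hq, hf]⟩
      · exact ⟨_, key (M.states.filter fun q => q ∉ M.final).toFinset (by simp [hq, hf])
          (by simp), by simp [hq, hf]⟩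
    · rintro ⟨Y, hY, hq⟩
      rcases (mem_initialBlocks hY).2 with h | h <;> exact ((h q).1 hq).1
  · rintro ⟨Y, c⟩ hv
    exact (List.mem_product.1 hv).1
  · intro Y hY p hp q hq
    rcases (mem_initialBlocks hY).2 with h | h
    · exact iff_of_true ((h p).1 hp).2 ((h q).1 hq).2
    · exact iff_of_false ((h p).1 hp).2 ((h q).1 hq).2
  · intro Y hY p hp q hq hpq hpY
    have : p ∈ M.final ↔ q ∈ M.final := by simpa [FA.Acc] using hpq []
    rcases (mem_initialBlocks hY).2 with h | h
    · exact (h q).2 ⟨hq, this.1 ((h p).1 hpY).2⟩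
    · exact (h q).2 ⟨hq, fun hq' => ((h p).1 hpY).2 (this.2 hq')⟩
  -- All pairs of a block and a letter are waiting, so a block that violates stability is its own
  -- witness.
  · intro Y _ p _ q _ a Z hZ
    rw [or_iff_not_imp_left]
    exact fun h => ⟨Z, List.mem_product.2 ⟨hZ, hl a⟩, h⟩

variable [DecidableEq A]

/-- The quotient of an automaton by a partition of its states. -/
def quotientFA (M : FA A S) (P : List (Finset S)) : FA A ℕ where
  states := List.range P.length
  start := blockIdx P M.start
  trans := (M.trans.map fun t => (blockIdx P t.1, t.2.1, blockIdx P t.2.2)).dedup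
  final := (M.final.map (blockIdx P)).dedup

theorem mem_quotientFA_trans {i j : ℕ} {a : A} : (i, a, j) ∈ (quotientFA M P).trans ↔
    ∃ p q, (p, a, q) ∈ M.trans ∧ blockIdx P p = i ∧ blockIdx P q = j := by
  simp only [quotientFA, List.mem_dedup, List.mem_map, Prod.exists, Prod.mk.injEq]
  constructor
  · rintro ⟨p, _, q, h, rfl, rfl, rfl⟩
    exact ⟨p, q, h, rfl, rfl⟩
  · rintro ⟨p, q, h, rfl, rfl⟩
    exact ⟨p, a, q, h, rfl, rfl, rfl⟩

theorem RefineInv.quotientFA_acc (h : RefineInv M P []) (hM : M.IsDFA) {p : S}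
    (hp : p ∈ M.states) (w : List A) :
    (quotientFA M P).Acc (blockIdx P p) w ↔ M.Acc p w := by
  induction w generalizing p with
  | nil =>
    constructor
    · rintro ⟨r, hr, e⟩
      simp only [quotientFA, List.mem_dedup, List.mem_map] at hr
      obtain ⟨q, hq, rfl⟩ := hr
      exact ((h.blockIdx_eq_iff hM hp (hM.final_mem q hq)).1 e []).2 ⟨q, hq, rfl⟩
    · rintro ⟨q, hq, rfl⟩
      exact ⟨_, List.mem_dedup.2 (List.mem_map_of_mem hq), rfl⟩
  | cons a w ih =>
    rw [FA.acc_cons]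
    constructor
    · rintro ⟨j, hj, hw⟩
      obtain ⟨p', q, ht, e, rfl⟩ := mem_quotientFA_trans.1 hj
      rw [ih (hM.trans_mem _ ht).2] at hw
      exact ((h.blockIdx_eq_iff hM (hM.trans_mem _ ht).1 hp).1 e _).1 (FA.acc_cons.2 ⟨q, ht, hw⟩)
    · intro hw
      obtain ⟨q, ht, hw⟩ := FA.acc_cons.1 hw
      exact ⟨_, mem_quotientFA_trans.2 ⟨p, q, ht, rfl, rfl⟩, (ih (hM.trans_mem _ ht).2).2 hw⟩

theorem quotientFA_path {p q : S} {w : List A} (hw : M.Path p w q) :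
    (quotientFA M P).Path (blockIdx P p) w (blockIdx P q) := by
  induction w generalizing p with
  | nil => exact congrArg _ hw
  | cons a w ih =>
    obtain ⟨r, hr, hw⟩ := hw
    exact ⟨_, mem_quotientFA_trans.2 ⟨p, r, hr, rfl, rfl⟩, ih hw⟩

theorem RefineInv.blockIdx_mem (h : RefineInv M P []) {q : S} (hq : q ∈ M.states) :
    blockIdx P q ∈ (quotientFA M P).states :=
  List.mem_range.2 (getElem_blockIdx ((h.cover q).1 hq)).1

theorem RefineInv.quotientFA_isMinimal (h : RefineInv M P []) (hM : M.IsDFA)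
    (hacc : M.Accessible) (hco : M.Coaccessible) : (quotientFA M P).IsMinimal where
  nodup := List.nodup_range
  start_mem := h.blockIdx_mem hM.start_mem
  final_mem i hi := by
    obtain ⟨q, hq, rfl⟩ := List.mem_map.1 (List.mem_dedup.1 hi)
    exact h.blockIdx_mem (hM.final_mem q hq)
  trans_mem := by
    rintro ⟨i, a, j⟩ hij
    obtain ⟨p, q, ht, rfl, rfl⟩ := mem_quotientFA_trans.1 hij
    have hm := hM.trans_mem _ ht
    exact ⟨h.blockIdx_mem hm.1, h.blockIdx_mem hm.2⟩
  det i a j k hj hk := by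
    obtain ⟨p, q, ht, rfl, rfl⟩ := mem_quotientFA_trans.1 hj
    obtain ⟨p', q', ht', e, rfl⟩ := mem_quotientFA_trans.1 hk
    rw [h.blockIdx_eq_iff hM (hM.trans_mem _ ht).2 (hM.trans_mem _ ht').2]
    intro w
    rw [← hM.acc_append (v := [a]) (p := p) ⟨q, ht, rfl⟩,
      ← hM.acc_append (v := [a]) (p := p') ⟨q', ht', rfl⟩]
    exact ((h.blockIdx_eq_iff hM (hM.trans_mem _ ht').1 (hM.trans_mem _ ht).1).1 e _).symm
  accessible i hi := by
    obtain ⟨q, hq, rfl⟩ := h.exists_blockIdx (List.mem_range.1 hi)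
    obtain ⟨w, hw⟩ := hacc q hq
    exact ⟨w, quotientFA_path hw⟩
  coaccessible i hi := by
    obtain ⟨q, hq, rfl⟩ := h.exists_blockIdx (List.mem_range.1 hi)
    obtain ⟨w, hw⟩ := hco q hq
    exact ⟨w, (h.quotientFA_acc hM hq w).2 hw⟩
  distinct i hi j hj hij := by
    obtain ⟨p, hp, rfl⟩ := h.exists_blockIdx (List.mem_range.1 hi)
    obtain ⟨q, hq, rfl⟩ := h.exists_blockIdx (List.mem_range.1 hj)
    rw [h.blockIdx_eq_iff hM hp hq]
    intro w
    rw [← h.quotientFA_acc hM hp, ← h.quotientFA_acc hM hq]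
    exact hij w
  trans_nodup := List.nodup_dedup _

theorem minimize_eq : minimize letters M = (do
    let N ← trim M
    tick N.states.length
    let P ← refine letters N (letters.length * (N.states.length + 2)) (initialBlocks N)
      (initialBlocks N ×ˢ letters)
    tick N.trans.length
    return quotientFA N P) := rfl

/-- The time bound is of order states times transitions. It charges every splitter for all
transitions and takes no advantage of the choice of the smaller half. -/
theorem minimize_spec (hM : M.IsDFA) (hf : M.final.Nodup) (hacc : M.Accessible)
    (hs : ∃ w, M.Acc M.start w) (hl : ∀ a, a ∈ letters) (hnl : letters.Nodup) :
    (minimize letters M).val.IsMinimal ∧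
      (∀ w, (minimize letters M).val.Acc (minimize letters M).val.start w ↔ M.Acc M.start w) ∧
      (minimize letters M).time ≤
        (M.states.length + letters.length * (M.states.length + 2) + 2) *
          (1 + M.trans.length) + M.states.length := by
  have hN := trim_isDFA hM hf hs
  have hco := trim_coaccessible hM hf
  -- The initial splitters cancel against the term for the initial blocks in the potential, so the
  -- iteration bound only has to reach the number of letters times the number of states.
  obtain ⟨h1, h2⟩ := refine_spec hN hco hl hnl
    (letters.length * ((trim M).val.states.length + 2)) (initialBlocks_inv hl hnl) (by
      rw [List.length_product, Nat.mul_add, Nat.mul_comm (initialBlocks _).length]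
      omega)
  rw [minimize_eq]
  simp only [Timed.val_bind, Timed.val_pure, Timed.time_bind, Timed.time_pure, tick_time]
  refine ⟨h1.quotientFA_isMinimal hN (trim_accessible hM hf hacc) hco, fun w => ?_, ?_⟩
  · exact (h1.quotientFA_acc hN hN.start_mem w).trans (trim_acc hM hf)
  · have h3 := trim_time_le hM hf
    have h4 : (trim M).val.states.length ≤ M.states.length := List.length_filter_le _ _
    have h5 : (trim M).val.trans.length ≤ M.trans.length := List.length_filter_le _ _
    have h6 : letters.length * ((trim M).val.states.length + 2) *
        (1 + (trim M).val.trans.length) ≤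
        letters.length * (M.states.length + 2) * (1 + M.trans.length) := by gcongr
    rw [Nat.add_mul, Nat.add_mul, Nat.mul_add 2]
    omega

end Minimize

/-! ### Valid Fibonacci representations -/

section Valid

/-- No factor `11` occurs in `w` when it is preceded by the digit `e`. -/
def NoConsec : Bit → List Bit → Prop
  | _, [] => True
  | e, b :: w => ¬ (e = 1 ∧ b = 1) ∧ NoConsec b w

/-- The last digit of `w`, or `e` if there is none. -/
def endBit (e : Bit) : List Bit → Bit
  | [] => e
  | b :: w => endBit b w

theorem noConsec_append {e : Bit} {v w : List Bit} :
    NoConsec e (v ++ w) ↔ NoConsec e v ∧ NoConsec (endBit e v) w := by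
  induction v generalizing e with
  | nil => simp [NoConsec, endBit]
  | cons b v ih => simp [NoConsec, endBit, ih, and_assoc]

theorem endBit_append {e : Bit} {v w : List Bit} :
    endBit e (v ++ w) = endBit (endBit e v) w := by
  induction v generalizing e with
  | nil => rfl
  | cons b v ih => exact ih

theorem noConsec_iff {e : Bit} {w : List Bit} :
    NoConsec e w ↔ Valid w ∧ ¬ (e = 1 ∧ w.head? = some 1) := by
  induction w generalizing e with
  | nil => simp [NoConsec, Valid]
  | cons b w ih =>
    have : Valid (b :: w) ↔ Valid w ∧ ¬ (b = 1 ∧ w.head? = some 1) := by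
      rw [Valid, List.infix_cons_iff, not_or, and_comm]
      refine and_congr_right fun _ => not_congr ?_
      cases w with
      | nil => simp
      | cons c w => simp [eq_comm]
    rw [NoConsec, ih, this]
    simp only [List.head?_cons, Option.some.injEq]
    tauto

theorem valid_iff {w : List Bit} : Valid w ↔ NoConsec 0 w := by
  simp [noConsec_iff]

theorem fibVal_zero_cons (w : List Bit) : fibVal (0 :: w) = fibVal w := by
  simp [fibVal]

theorem fibVal_one_cons (w : List Bit) : fibVal (1 :: w) = Nat.fib (w.length + 2) + fibVal w := by
  simp [fibVal]

/-- The two bounds need each other: after a leading 1 the rest satisfies the second one, and the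
Fibonacci recurrence adds up to the first. -/
theorem fibVal_lt (w : List Bit) :
    (NoConsec 0 w → fibVal w < Nat.fib (w.length + 2)) ∧
      (NoConsec 1 w → fibVal w < Nat.fib (w.length + 1)) := by
  induction w with
  | nil => simp [fibVal]
  | cons b w ih =>
    have h2 := Nat.fib_add_two (n := w.length)
    have h3 := Nat.fib_add_two (n := w.length + 1)
    rw [List.length_cons]
    rcases (by revert b; decide : b = 0 ∨ b = 1) with rfl | rfl
    · rw [fibVal_zero_cons]
      refine ⟨fun h => (ih.1 h.2).trans_le ?_, fun h => ih.1 h.2⟩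
      exact Nat.fib_mono (by omega)
    · rw [fibVal_one_cons]
      refine ⟨fun h => ?_, fun h => absurd ⟨rfl, rfl⟩ h.1⟩
      have h1 := ih.2 h.2
      have h4 : Nat.fib (w.length + 1 + 2) = Nat.fib (w.length + 1) + Nat.fib (w.length + 2) := h3
      omega

/-- Greedy expansion: the leading digit is 1 exactly when the number is at least F_{L+2}, and then
the remainder is below F_{L+1}, small enough for a word that may follow a 1. -/
theorem exists_representation (L : ℕ) :
    (∀ N < Nat.fib (L + 2), ∃ w : List Bit, w.length = L ∧ NoConsec 0 w ∧ fibVal w = N) ∧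
      (∀ N < Nat.fib (L + 1), ∃ w : List Bit, w.length = L ∧ NoConsec 1 w ∧ fibVal w = N) := by
  induction L with
  | zero =>
    refine ⟨fun N hN => ⟨[], rfl, trivial, ?_⟩, fun N hN => ⟨[], rfl, trivial, ?_⟩⟩ <;>
    · simp at hN
      simp [fibVal, hN]
  | succ L ih =>
    have h3 : Nat.fib (L + 1 + 2) = Nat.fib (L + 1) + Nat.fib (L + 2) := Nat.fib_add_two
    have key : ∀ e : Bit, ∀ N < Nat.fib (L + 2),
        ∃ w : List Bit, w.length = L + 1 ∧ NoConsec e w ∧ fibVal w = N := by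
      intro e N hN
      obtain ⟨w, hw, hv, rfl⟩ := ih.1 N hN
      exact ⟨0 :: w, by simp [hw], ⟨by simp, hv⟩, by simp [fibVal]⟩
    refine ⟨fun N hN => ?_, key 1⟩
    by_cases h : N < Nat.fib (L + 2)
    · exact key 0 N h
    · obtain ⟨w, hw, hv, hN'⟩ := ih.2 (N - Nat.fib (L + 2)) (by omega)
      refine ⟨1 :: w, by simp [hw], ⟨by simp, hv⟩, ?_⟩
      rw [fibVal_one_cons, hw, hN']
      omega

end Valid

/-! ### Sequences attached to words -/

section Runs

variable {L L' : Type}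

/-- The sequence `s(k)` of the values of a word followed by `k` zeros, given by `(s(0), s(1))`,
after one more letter with coefficient `c`. -/
def seqNext (s : ℤ × ℤ) (c : ℤ) : ℤ × ℤ := (s.2 + c, s.1 + s.2 + 2 * c)

/-- The sequence obtained from `s` by reading a word whose letters have the coefficients `c`. -/
def seqRun (c : L → ℤ) (s : ℤ × ℤ) : List L → ℤ × ℤ
  | [] => s
  | l :: w => seqRun c (seqNext s (c l)) w

theorem seqRun_append (c : L → ℤ) (s : ℤ × ℤ) (v w : List L) :
    seqRun c s (v ++ w) = seqRun c (seqRun c s v) w := by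
  induction v generalizing s with
  | nil => rfl
  | cons l v ih => exact ih _

theorem seqRun_map (c : L → ℤ) (f : L' → L) (s : ℤ × ℤ) (w : List L') :
    seqRun c s (w.map f) = seqRun (fun l => c (f l)) s w := by
  induction w generalizing s with
  | nil => rfl
  | cons l w ih => exact ih _

theorem seqRun_add_mul (c d : L → ℤ) (k : ℤ) (s t : ℤ × ℤ) (w : List L) :
    seqRun (fun l => c l + k * d l) (s + k • t) w = seqRun c s w + k • seqRun d t w := by
  induction w generalizing s t with
  | nil => rfl
  | cons l w ih =>
    have : seqNext (s + k • t) (c l + k * d l) = seqNext s (c l) + k • seqNext t (d l) := by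
      ext <;> simp [seqNext] <;> ring
    simp only [seqRun, this, ih]

theorem seqRun_zero_add_mul (c d : L → ℤ) (k : ℤ) (w : List L) :
    seqRun (fun l => c l + k * d l) 0 w = seqRun c 0 w + k • seqRun d 0 w := by
  simpa using seqRun_add_mul c d k 0 0 w

/-- After k letters the initial sequence contributes s(k) = s(0) F_{k-1} + s(1) F_k. Writing F_{k-1}
as F_{k+1} - F_k also gives the right value 1 at k = 0. -/
theorem seqRun_digit_fst (f : L → Bit) (s : ℤ × ℤ) (w : List L) :
    (seqRun (fun l => ((f l).val : ℤ)) s w).1 =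
      s.1 * (Nat.fib (w.length + 1) - Nat.fib w.length) + s.2 * Nat.fib w.length +
        fibVal (w.map f) := by
  induction w generalizing s with
  | nil => simp [seqRun, fibVal]
  | cons l w ih =>
    have h2 : (Nat.fib (w.length + 1 + 1) : ℤ) = Nat.fib w.length + Nat.fib (w.length + 1) := by
      exact_mod_cast Nat.fib_add_two
    simp only [seqRun, ih, seqNext, List.map_cons, fibVal, List.length_cons, List.length_map,
      Nat.cast_add, Nat.cast_mul, h2]
    ring

theorem seqRun_digit_zero_fst (f : L → Bit) (w : List L) :
    (seqRun (fun l => ((f l).val : ℤ)) 0 w).1 = fibVal (w.map f) := by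
  simp [seqRun_digit_fst]

/-- The region is closed under reading a letter: the new terms are at least 3a - a and 2a + 3a - 2a.
-/
theorem seqRun_ne_zero_of_high {c : L → ℤ} {a : ℤ} (ha : 1 ≤ a) (hc : ∀ l, -a ≤ c l) {s : ℤ × ℤ}
    (h1 : 2 * a ≤ s.1) (h2 : 3 * a ≤ s.2) (w : List L) : (seqRun c s w).1 ≠ 0 := by
  induction w generalizing s with
  | nil =>
    simp only [seqRun]
    omega
  | cons l w ih =>
    have := hc l
    exact ih (by simp only [seqNext]; omega) (by simp only [seqNext]; omega)

theorem seqRun_ne_zero_of_low {c : L → ℤ} {b : ℤ} (hb : 1 ≤ b) (hc : ∀ l, c l ≤ b) {s : ℤ × ℤ}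
    (h1 : s.1 ≤ -(2 * b)) (h2 : s.2 ≤ -(3 * b)) (w : List L) : (seqRun c s w).1 ≠ 0 := by
  induction w generalizing s with
  | nil =>
    simp only [seqRun]
    omega
  | cons l w ih =>
    have := hc l
    exact ih (by simp only [seqNext]; omega) (by simp only [seqNext]; omega)

/-- The quantity s(1) - φ s(0) isolates the contracting eigendirection of the recurrence. A letter
multiplies it by ψ and adds c ψ^2, and the bound K is preserved exactly because |ψ| + ψ^2 = 1. -/
theorem abs_sub_goldenRatio_mul_le {c : L → ℤ} {K : ℤ} (hc : ∀ l, |c l| ≤ K) {s : ℤ × ℤ}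
    (hs : |(s.2 : ℝ) - Real.goldenRatio * s.1| ≤ K) (w : List L) :
    |((seqRun c s w).2 : ℝ) - Real.goldenRatio * (seqRun c s w).1| ≤ K := by
  induction w generalizing s with
  | nil => exact hs
  | cons l w ih =>
    refine ih ?_
    have e : ((seqNext s (c l)).2 : ℝ) - Real.goldenRatio * (seqNext s (c l)).1 =
        Real.goldenConj * (s.2 - Real.goldenRatio * s.1) + c l * Real.goldenConj ^ 2 := by
      simp only [seqNext]
      push_cast
      have h2 := Real.goldenRatio_add_goldenConj
      have h3 := Real.goldenConj_sq
      have h4 : Real.goldenRatio = 1 - Real.goldenConj := by linarith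
      rw [h4]
      linear_combination (-(s.1 + c l) : ℝ) * h3
    have hcl : |(c l : ℝ)| ≤ K := by exact_mod_cast hc l
    have hneg : |Real.goldenConj| = -Real.goldenConj := abs_of_neg Real.goldenConj_neg
    have hsq : |Real.goldenConj ^ 2| = Real.goldenConj + 1 := by
      rw [abs_of_nonneg (sq_nonneg _), Real.goldenConj_sq]
    rw [e]
    refine (abs_add_le _ _).trans ?_
    rw [abs_mul, abs_mul, hneg, hsq]
    have h5 := Real.goldenConj_neg
    have h6 := Real.neg_one_lt_goldenConj
    nlinarith [mul_le_mul_of_nonneg_left hs (by linarith : 0 ≤ -Real.goldenConj),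
      mul_le_mul_of_nonneg_right hcl (by linarith : 0 ≤ Real.goldenConj + 1)]

/-- If a word with coefficients between `-K` and `K` can be completed to one of value `0`, the
sequence after it is bounded. -/
theorem seqRun_bounded {c : L → ℤ} {K : ℤ} (hK : 1 ≤ K) (hc : ∀ l, |c l| ≤ K) {w u : List L}
    (h : (seqRun c 0 (w ++ u)).1 = 0) :
    |(seqRun c 0 w).1| ≤ 9 * K ∧ |(seqRun c 0 w).2| ≤ 9 * K := by
  rw [seqRun_append] at h
  have hb := abs_sub_goldenRatio_mul_le hc (s := 0) (by simp; omega) w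
  set s := seqRun c 0 w
  have h1 := Real.one_lt_goldenRatio
  have h2 := Real.goldenRatio_lt_two
  rw [abs_le] at hb
  -- With s(0) ≥ 4K, the golden ratio estimate gives s(1) ≥ 4φK - K ≥ 3K, which is inside the region
  -- of no return.
  have hhi : s.1 < 4 * K := by
    by_contra hs
    rw [not_lt] at hs
    refine seqRun_ne_zero_of_high hK (fun l => (abs_le.1 (hc l)).1) (by omega) ?_ u h
    have hs' : (4 * K : ℝ) ≤ s.1 := by exact_mod_cast hs
    have hK' : (1 : ℝ) ≤ K := by exact_mod_cast hK
    have : (3 * K : ℝ) ≤ s.2 := by nlinarith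
    exact_mod_cast this
  have hlo : -(4 * K) < s.1 := by
    by_contra hs
    rw [not_lt] at hs
    refine seqRun_ne_zero_of_low hK (fun l => (abs_le.1 (hc l)).2) (by omega) ?_ u h
    have hs' : (s.1 : ℝ) ≤ -(4 * K) := by exact_mod_cast hs
    have hK' : (1 : ℝ) ≤ K := by exact_mod_cast hK
    have : (s.2 : ℝ) ≤ -(3 * K) := by nlinarith
    exact_mod_cast this
  have hhi' : (s.1 : ℝ) < 4 * K := by exact_mod_cast hhi
  have hlo' : -(4 * K : ℝ) < s.1 := by exact_mod_cast hlo
  -- Here φ < 2 and |s(0)| < 4K give |s(1)| ≤ 8K + K.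
  have h3 : (s.2 : ℝ) ≤ 9 * K := by nlinarith
  have h4 : -(9 * K : ℝ) ≤ s.2 := by nlinarith
  refine ⟨abs_le.2 ⟨by omega, by omega⟩, abs_le.2 ⟨?_, ?_⟩⟩
  · exact_mod_cast h4
  · exact_mod_cast h3

end Runs

/-! ### The Fibonacci adder -/

section Adder

/-- The contribution of a letter of the adder. -/
def addCoef (l : Bit × Bit × Bit) : ℤ := (l.1.val : ℤ) + (l.2.1.val : ℤ) - (l.2.2.val : ℤ)

theorem addNext_eq (s : AddState) (l : Bit × Bit × Bit) : addNext s l = seqNext s (addCoef l) := rfl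

/-- The states of the adder together with the last digits with which they can occur after valid
words. -/
def adderConfigs : List (AddState × List (Bit × Bit × Bit)) := [
  ((0, 0), [(0, 0, 0), (0, 0, 1), (0, 1, 0), (0, 1, 1), (1, 0, 0), (1, 0, 1), (1, 1, 1)]),
  ((0, 1), [(0, 1, 0), (1, 0, 0), (1, 1, 0)]),
  ((0, -1), [(0, 0, 1)]),
  ((1, 1), [(0, 0, 0), (0, 0, 1), (0, 1, 1), (1, 0, 1)]),
  ((1, 2), [(0, 0, 0), (0, 1, 0), (0, 1, 1), (1, 0, 0), (1, 0, 1), (1, 1, 0), (1, 1, 1)]),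
  ((1, 3), [(1, 1, 0)]),
  ((2, 2), [(0, 0, 1)]),
  ((-1, -1), [(0, 0, 0), (0, 1, 0), (1, 0, 0), (1, 1, 0), (1, 1, 1)]),
  ((-1, -2), [(0, 0, 0), (0, 0, 1), (0, 1, 1), (1, 0, 1)]),
  ((-2, -2), [(1, 1, 0)]),
  ((-2, -3), [(0, 0, 0), (0, 1, 0), (0, 1, 1), (1, 0, 0), (1, 0, 1), (1, 1, 1)]),
  ((-2, -4), [(0, 0, 0), (0, 0, 1)]),
  ((-3, -4), [(0, 1, 0), (1, 0, 0), (1, 1, 0), (1, 1, 1)]),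
  ((-3, -5), [(0, 0, 0), (0, 0, 1), (0, 1, 0), (0, 1, 1), (1, 0, 0), (1, 0, 1)]),
  ((-3, -6), [(0, 0, 1)]),
  ((-4, -5), [(1, 1, 0)])]

/-- The state `s` can occur together with the last digits `l`. -/
abbrev IsConfig (s : AddState) (l : Bit × Bit × Bit) : Prop :=
  ∃ p ∈ adderConfigs, p.1 = s ∧ l ∈ p.2

theorem mem_addStates_of_isConfig {s : AddState} {l : Bit × Bit × Bit} (h : IsConfig s l) :
    s ∈ addStates := by
  obtain ⟨p, hp, rfl, -⟩ := h
  revert p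
  decide

theorem mem_triples (l : Bit × Bit × Bit) : l ∈ triples := by
  revert l
  decide

/-- A finite check: a step from a listed configuration stays in the list or lands in one of two
regions. These are absorbing, since the adder's coefficients lie between -1 and 2, and s(0) is
nonzero in both. -/
theorem isConfig_step {s : AddState} {l m : Bit × Bit × Bit} (h : IsConfig s l)
    (h1 : ¬ (l.1 = 1 ∧ m.1 = 1)) (h2 : ¬ (l.2.1 = 1 ∧ m.2.1 = 1)) (h3 : ¬ (l.2.2 = 1 ∧ m.2.2 = 1)) :
    IsConfig (addNext s m) m ∨ (2 ≤ (addNext s m).1 ∧ 3 ≤ (addNext s m).2) ∨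
      ((addNext s m).1 ≤ -4 ∧ (addNext s m).2 ≤ -6) := by
  obtain ⟨p, hp, rfl, hl⟩ := h
  have key : ∀ p ∈ adderConfigs, ∀ l ∈ p.2, ∀ m ∈ triples, ¬ (l.1 = 1 ∧ m.1 = 1) →
      ¬ (l.2.1 = 1 ∧ m.2.1 = 1) → ¬ (l.2.2 = 1 ∧ m.2.2 = 1) →
      IsConfig (addNext p.1 m) m ∨ (2 ≤ (addNext p.1 m).1 ∧ 3 ≤ (addNext p.1 m).2) ∨
      ((addNext p.1 m).1 ≤ -4 ∧ (addNext p.1 m).2 ≤ -6) := by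
    decide
  exact key p hp l hl m (mem_triples m) h1 h2 h3

end Adder

/-- The letters read from a state of `M_add'`, and the states they lead to. -/
def adderSucc (q : AddState × AddState × Bit) :
    Timed (List ((Bit × Bit × Bit) × (AddState × AddState × Bit))) := do
  let followed := adder.out q.1
  tick followed.length
  return (followed.filter fun t => ¬ (q.2.2 = 1 ∧ t.2.1.2.2 = 1)).map
    fun t => (t.2.1, (t.2.2, q.1, t.2.1.2.2))

/-- The exploration in the construction of `M_add'`. -/
def adderRun : Timed (List (AddState × AddState × Bit) ×
    List ((AddState × AddState × Bit) × (Bit × Bit × Bit) × (AddState × AddState × Bit))) :=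
  explore adderSucc (2 * addStates.length ^ 2) [((0, 0), (0, 0), 0)] [((0, 0), (0, 0), 0)] []

theorem adder'_eq : adder' = (do
    let r ← adderRun
    return {
      states := r.1
      start := ((0, 0), (0, 0), 0)
      trans := r.2
      final := r.1.filter fun q => q.1 ∈ adder.final }) := rfl

theorem adder'_states : adder'.val.states = adderRun.val.1 := by
  rw [adder'_eq]
  -- With the run abstracted, the projection is definitional and the exploration is not evaluated.
  generalize adderRun = r
  rfl

theorem adder'_trans : adder'.val.trans = adderRun.val.2 := by
  rw [adder'_eq]
  generalize adderRun = r
  rfl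

theorem adder'_start : adder'.val.start = ((0, 0), (0, 0), 0) := by
  rw [adder'_eq]
  generalize adderRun = r
  rfl

theorem adder'_final : adder'.val.final =
    adder'.val.states.filter fun q => q.1 ∈ adder.final := by
  rw [adder'_eq]
  generalize adderRun = r
  rfl

theorem mem_adder_trans {s s' : AddState} {l : Bit × Bit × Bit} :
    (s, l, s') ∈ adder.trans ↔ s ∈ addStates ∧ s' = addNext s l ∧ s' ∈ addStates := by
  refine List.mem_filter.trans ?_
  rw [List.mem_map, decide_eq_true_eq]
  constructor
  · rintro ⟨⟨⟨_, _⟩, hm, e⟩, h'⟩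
    simp only [Prod.mk.injEq] at e
    obtain ⟨rfl, rfl, rfl⟩ := e
    exact ⟨(List.mem_product.1 hm).1, rfl, h'⟩
  · rintro ⟨h, rfl, h'⟩
    exact ⟨⟨(s, l), List.mem_product.2 ⟨h, mem_triples l⟩, rfl⟩, h'⟩

theorem mem_adderSucc {q : AddState × AddState × Bit}
    {e : (Bit × Bit × Bit) × (AddState × AddState × Bit)} :
    e ∈ (adderSucc q).val ↔ q.1 ∈ addStates ∧ addNext q.1 e.1 ∈ addStates ∧
      ¬ (q.2.2 = 1 ∧ e.1.2.2 = 1) ∧ e.2 = (addNext q.1 e.1, q.1, e.1.2.2) := by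
  obtain ⟨l, r⟩ := e
  simp only [adderSucc, Timed.val_bind, Timed.val_pure, List.mem_map, List.mem_filter, FA.mem_out,
    decide_eq_true_eq]
  constructor
  · rintro ⟨⟨s, l, s'⟩, ⟨⟨h, rfl⟩, h'⟩, e⟩
    obtain ⟨h1, rfl, h2⟩ := mem_adder_trans.1 h
    obtain ⟨rfl, rfl⟩ := Prod.mk.injEq _ _ _ _ ▸ e
    exact ⟨h1, h2, h', rfl⟩
  · rintro ⟨h1, h2, h', rfl⟩
    exact ⟨(q.1, l, addNext q.1 l), ⟨⟨mem_adder_trans.2 ⟨h1, rfl, h2⟩, rfl⟩, h'⟩, rfl⟩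

theorem mem_bits (b : Bit) : b ∈ bits := by
  revert b
  decide

theorem adder'_explored : Explored adderSucc [((0, 0), (0, 0), 0)] adderRun := by
  refine explore_spec _ _ (addStates.toFinset ×ˢ addStates.toFinset ×ˢ bits.toFinset) _
    (List.nodup_singleton _) ?_ ?_ ?_
  · intro s hs
    rw [List.mem_singleton] at hs
    subst hs
    decide
  · rintro q - e he
    obtain ⟨h1, h2, -, h3⟩ := mem_adderSucc.1 he
    simp [h3, h1, h2, mem_bits]
  · rw [Finset.card_product, Finset.card_product]
    have h1 := List.toFinset_card_le addStates
    have h2 := List.toFinset_card_le bits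
    have h3 : bits.length = 2 := rfl
    calc _ ≤ addStates.length * (addStates.length * 2) :=
          Nat.mul_le_mul h1 (Nat.mul_le_mul h1 (h2.trans_eq h3))
      _ = _ := by ring

theorem mem_adder'_trans {q r : AddState × AddState × Bit} {l : Bit × Bit × Bit} :
    (q, l, r) ∈ adder'.val.trans ↔ q ∈ adder'.val.states ∧ q.1 ∈ addStates ∧
      addNext q.1 l ∈ addStates ∧ ¬ (q.2.2 = 1 ∧ l.2.2 = 1) ∧
      r = (addNext q.1 l, q.1, l.2.2) := by
  rw [adder'_trans, adder'_states, adder'_explored.mem_trans, mem_adderSucc]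

theorem mem_adder'_final {q : AddState × AddState × Bit} :
    q ∈ adder'.val.final ↔ q ∈ adder'.val.states ∧ q.1 ∈ addStates ∧ q.1.1 = 0 := by
  rw [adder'_final, List.mem_filter]
  simp [adder]

theorem adder'_isDFA : adder'.val.IsDFA where
  nodup := by
    rw [adder'_states]
    exact adder'_explored.nodup
  start_mem := by
    rw [adder'_start, adder'_states]
    exact adder'_explored.init_mem _ (List.mem_singleton_self _)
  final_mem q hq := (mem_adder'_final.1 hq).1
  trans_mem t ht := by
    rw [adder'_trans] at ht
    rw [adder'_states]
    have := (adder'_explored.mem_trans (t := t)).1 ht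
    exact ⟨this.1, adder'_explored.closed _ this.1 _ this.2⟩
  det p a q r hq hr := by
    rw [mem_adder'_trans] at hq hr
    exact hq.2.2.2.2.trans hr.2.2.2.2.symm

theorem adder'_path {w : List (Bit × Bit × Bit)} {q : AddState × AddState × Bit}
    (h : adder'.val.Path adder'.val.start w q) :
    q.1 = seqRun addCoef 0 w ∧ q.1 ∈ addStates ∧ q.2.1 ∈ addStates ∧
      q.2.2 = endBit 0 (w.map fun l => l.2.2) ∧ NoConsec 0 (w.map fun l => l.2.2) := by
  induction w using List.reverseRecOn generalizing q with
  | nil =>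
    obtain rfl := FA.path_nil.1 h
    rw [adder'_start]
    exact ⟨rfl, by decide, by decide, rfl, trivial⟩
  | append_singleton w l ih =>
    obtain ⟨r, hr, ht⟩ := FA.path_concat.1 h
    obtain ⟨h1, h2, -, h4, h5⟩ := ih hr
    obtain ⟨-, -, h6, h7, rfl⟩ := mem_adder'_trans.1 ht
    rw [List.map_append, endBit_append, noConsec_append, seqRun_append, ← h1, ← h4]
    exact ⟨rfl, h6, h2, rfl, h5, h7, trivial⟩

theorem addCoef_bounds (l : Bit × Bit × Bit) : -1 ≤ addCoef l ∧ addCoef l ≤ 2 := by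
  revert l
  decide

/-- Leaving the 16 states is harmless: a valid word either has a path or has already put its
sequence in a region where the sum can never return to 0. -/
theorem adder'_exists_path {w : List (Bit × Bit × Bit)}
    (h1 : NoConsec 0 (w.map fun l => l.1)) (h2 : NoConsec 0 (w.map fun l => l.2.1))
    (h3 : NoConsec 0 (w.map fun l => l.2.2)) :
    (∃ q, adder'.val.Path adder'.val.start w q ∧ IsConfig q.1 (endBit 0 (w.map fun l => l.1),
      endBit 0 (w.map fun l => l.2.1), endBit 0 (w.map fun l => l.2.2))) ∨
    (2 ≤ (seqRun addCoef 0 w).1 ∧ 3 ≤ (seqRun addCoef 0 w).2) ∨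
      ((seqRun addCoef 0 w).1 ≤ -4 ∧ (seqRun addCoef 0 w).2 ≤ -6) := by
  induction w using List.reverseRecOn with
  | nil => exact Or.inl ⟨_, rfl, by rw [adder'_start]; decide⟩
  | append_singleton w l ih =>
    simp only [List.map_append, noConsec_append, endBit_append] at h1 h2 h3 ⊢
    obtain ⟨hl1, hl2⟩ := addCoef_bounds l
    rw [seqRun_append]
    simp only [seqRun]
    rcases ih h1.1 h2.1 h3.1 with ⟨q, hq, hc⟩ | ⟨ha, hb⟩ | ⟨ha, hb⟩
    · obtain ⟨e1, e2, -, e4, -⟩ := adder'_path hq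
      have hstep := isConfig_step hc h1.2.1 h2.2.1 h3.2.1
      rw [← e1, ← addNext_eq]
      rcases hstep with hstep | hstep
      · refine Or.inl ⟨_, FA.path_concat.2 ⟨q, hq, mem_adder'_trans.2
          ⟨FA.path_mem adder'_isDFA.trans_mem adder'_isDFA.start_mem hq, e2,
          mem_addStates_of_isConfig hstep, e4 ▸ h3.2.1, rfl⟩⟩, hstep⟩
      · exact Or.inr hstep
    · exact Or.inr (Or.inl ⟨by simp only [seqNext]; omega, by simp only [seqNext]; omega⟩)
    · exact Or.inr (Or.inr ⟨by simp only [seqNext]; omega, by simp only [seqNext]; omega⟩)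

theorem adder'_acc {w : List (Bit × Bit × Bit)} (h1 : Valid (w.map fun l => l.1))
    (h2 : Valid (w.map fun l => l.2.1)) :
    adder'.val.Acc adder'.val.start w ↔ Valid (w.map fun l => l.2.2) ∧
      (seqRun addCoef 0 w).1 = 0 := by
  rw [valid_iff] at h1 h2 ⊢
  constructor
  · rintro ⟨q, hq, hw⟩
    obtain ⟨e1, -, -, -, e5⟩ := adder'_path hw
    exact ⟨e5, e1 ▸ (mem_adder'_final.1 hq).2.2⟩
  · rintro ⟨h3, h0⟩
    rcases adder'_exists_path h1 h2 h3 with ⟨q, hq, hc⟩ | h | h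
    · obtain ⟨e1, e2, -⟩ := adder'_path hq
      exact ⟨q, mem_adder'_final.2 ⟨FA.path_mem adder'_isDFA.trans_mem adder'_isDFA.start_mem hq,
        e2, e1 ▸ h0⟩, hq⟩
    · omega
    · omega

theorem abs_le_of_mem_addStates {s : AddState} (h : s ∈ addStates) : |s.1| ≤ 6 ∧ |s.2| ≤ 6 := by
  revert s
  decide

/-! ### Keys of prefixes and the states of the minimal automaton -/

/-- The contribution of a letter of `x × y` to `[y] - n [x]`. -/
def mulCoef (n : ℕ) (l : Bit × Bit) : ℤ := (l.2.val : ℤ) + -n * (l.1.val : ℤ)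

/-- The data of a prefix `x × y` that determine its continuations to words of the language. -/
def mulKey (n : ℕ) (w : List (Bit × Bit)) : (ℤ × ℤ) × Bit × Bit :=
  (seqRun (mulCoef n) 0 w, endBit 0 (w.map Prod.fst), endBit 0 (w.map Prod.snd))

theorem mem_mulLanguage {n : ℕ} {w : List (Bit × Bit)} : w ∈ mulLanguage n ↔
    NoConsec 0 (w.map Prod.fst) ∧ NoConsec 0 (w.map Prod.snd) ∧
      (seqRun (mulCoef n) 0 w).1 = 0 := by
  have h1 : (seqRun (mulCoef n) 0 w).1 =
      fibVal (w.map Prod.snd) - n * fibVal (w.map Prod.fst) := by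
    have := seqRun_zero_add_mul (fun l : Bit × Bit => (l.2.val : ℤ))
      (fun l => (l.1.val : ℤ)) (-n) w
    change (seqRun (fun l : Bit × Bit => (l.2.val : ℤ) + -n * (l.1.val : ℤ)) 0 w).1 = _
    rw [this]
    simp [seqRun_digit_zero_fst, sub_eq_add_neg]
  have h2 : w ∈ mulLanguage n ↔ Valid (w.map Prod.fst) ∧ Valid (w.map Prod.snd) ∧
    fibVal (w.map Prod.snd) = n * fibVal (w.map Prod.fst) := Iff.rfl
  rw [h2, valid_iff, valid_iff, h1, sub_eq_zero]
  norm_cast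

theorem append_mem_mulLanguage {n : ℕ} {w w' u : List (Bit × Bit)}
    (h : mulKey n w = mulKey n w') (h1 : NoConsec 0 (w'.map Prod.fst))
    (h2 : NoConsec 0 (w'.map Prod.snd)) (hu : w ++ u ∈ mulLanguage n) :
    w' ++ u ∈ mulLanguage n := by
  simp only [mulKey, Prod.mk.injEq] at h
  rw [mem_mulLanguage] at hu ⊢
  simp only [List.map_append, noConsec_append, seqRun_append, h.1, h.2.1, h.2.2] at hu ⊢
  exact ⟨⟨h1, hu.1.2⟩, ⟨h2, hu.2.1.2⟩, hu.2.2⟩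

theorem abs_mulCoef_le {n : ℕ} (hn : 1 ≤ n) (l : Bit × Bit) : |mulCoef n l| ≤ n := by
  obtain ⟨a, b⟩ := l
  have ha : (a.val : ℤ) = 0 ∨ (a.val : ℤ) = 1 := by omega
  have hb : (b.val : ℤ) = 0 ∨ (b.val : ℤ) = 1 := by omega
  rw [abs_le, mulCoef]
  rcases ha with h | h <;> rcases hb with h' | h' <;> rw [h, h'] <;> constructor <;> omega

/-- The automaton `M` is the minimal one for `[y] = n [x]`. -/
structure IsMulFA (n : ℕ) (M : FA (Bit × Bit) ℕ) : Prop extends M.IsMinimal where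
  acc_iff : ∀ w, M.Acc M.start w ↔ w ∈ mulLanguage n

section IsMulFA

variable {n : ℕ} {M : FA (Bit × Bit) ℕ}

theorem IsMulFA.exists_append_mem (hM : IsMulFA n M) {w : List (Bit × Bit)} {q : ℕ} (h : M.Path M.start w q) :
    ∃ u, w ++ u ∈ mulLanguage n := by
  obtain ⟨u, hu⟩ := hM.coaccessible q (FA.path_mem hM.trans_mem hM.start_mem h)
  exact ⟨u, (hM.acc_iff _).1 ((hM.acc_append h).2 hu)⟩

theorem IsMulFA.noConsec (hM : IsMulFA n M) {w : List (Bit × Bit)} {q : ℕ} (h : M.Path M.start w q) :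
    NoConsec 0 (w.map Prod.fst) ∧ NoConsec 0 (w.map Prod.snd) := by
  obtain ⟨u, hu⟩ := hM.exists_append_mem h
  rw [mem_mulLanguage, List.map_append, List.map_append, noConsec_append, noConsec_append] at hu
  exact ⟨hu.1.1, hu.2.1.1⟩

/-- The Myhill–Nerode argument: prefixes with equal keys have the same completions, and states of a
minimal automaton are separated by their languages. -/
theorem IsMulFA.eq_of_mulKey_eq (hM : IsMulFA n M) {w w' : List (Bit × Bit)} {q q' : ℕ} (h : M.Path M.start w q)
    (h' : M.Path M.start w' q') (hk : mulKey n w = mulKey n w') : q = q' := by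
  refine hM.distinct q (FA.path_mem hM.trans_mem hM.start_mem h) q'
    (FA.path_mem hM.trans_mem hM.start_mem h') fun u => ?_
  rw [← hM.acc_append h, ← hM.acc_append h', hM.acc_iff, hM.acc_iff]
  obtain ⟨h1, h2⟩ := hM.noConsec h
  obtain ⟨h1', h2'⟩ := hM.noConsec h'
  exact ⟨append_mem_mulLanguage hk h1' h2', append_mem_mulLanguage hk.symm h1 h2⟩

/-- One function `ρ` recovers every reachable state from its key. It serves both to count the states
of `M` and to decode the sets of the subset construction. -/
theorem IsMulFA.exists_stateOfKey (hM : IsMulFA n M) : ∃ ρ : (ℤ × ℤ) × Bit × Bit → ℕ,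
    ∀ w q, M.Path M.start w q → ρ (mulKey n w) = q := by
  classical
  refine ⟨fun k => if h : ∃ q w, M.Path M.start w q ∧ mulKey n w = k then h.choose else 0,
    fun w q hw => ?_⟩
  have h : ∃ q' w', M.Path M.start w' q' ∧ mulKey n w' = mulKey n w := ⟨q, w, hw, rfl⟩
  beta_reduce
  rw [dif_pos h]
  obtain ⟨w', hw', hk⟩ := h.choose_spec
  exact hM.eq_of_mulKey_eq hw' hw hk

theorem IsMulFA.run_bounded (hM : IsMulFA n M) (hn : 1 ≤ n) {w : List (Bit × Bit)} {q : ℕ}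
    (h : M.Path M.start w q) :
    |(seqRun (mulCoef n) 0 w).1| ≤ 9 * n ∧ |(seqRun (mulCoef n) 0 w).2| ≤ 9 * n := by
  obtain ⟨u, hu⟩ := hM.exists_append_mem h
  exact seqRun_bounded (by exact_mod_cast hn) (abs_mulCoef_le hn) (mem_mulLanguage.1 hu).2.2

end IsMulFA

/-- The pairs of integers of absolute value at most `K`. -/
noncomputable def intBox (K : ℕ) : Finset (ℤ × ℤ) := Finset.Icc (-(K : ℤ)) K ×ˢ Finset.Icc (-(K : ℤ)) K

theorem mem_intBox {K : ℕ} {s : ℤ × ℤ} : s ∈ intBox K ↔ |s.1| ≤ K ∧ |s.2| ≤ K := by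
  simp only [intBox, Finset.mem_product, Finset.mem_Icc, abs_le]

theorem card_intBox (K : ℕ) : (intBox K).card = (2 * K + 1) ^ 2 := by
  rw [intBox, Finset.card_product, Int.card_Icc, sq]
  congr 1 <;> omega

theorem mem_pairs (l : Bit × Bit) : l ∈ pairs := by
  revert l
  decide

theorem IsMulFA.states_length_le {n : ℕ} {M : FA (Bit × Bit) ℕ} (hM : IsMulFA n M) (hn : 1 ≤ n) :
    M.states.length ≤ 1444 * n ^ 2 := by
  obtain ⟨ρ, hρ⟩ := hM.exists_stateOfKey
  rw [← List.toFinset_card_of_nodup hM.nodup]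
  have hsub : M.states.toFinset ⊆
      (intBox (9 * n) ×ˢ (Finset.univ : Finset (Bit × Bit))).image ρ := by
    intro q hq
    obtain ⟨w, hw⟩ := hM.accessible q (List.mem_toFinset.1 hq)
    refine Finset.mem_image.2 ⟨mulKey n w, Finset.mem_product.2
      ⟨mem_intBox.2 ?_, Finset.mem_univ _⟩, hρ w q hw⟩
    exact_mod_cast hM.run_bounded hn hw
  refine (Finset.card_le_card hsub).trans (Finset.card_image_le.trans ?_)
  rw [Finset.card_product, card_intBox]
  have h4 : (Finset.univ : Finset (Bit × Bit)).card = 4 := rfl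
  rw [h4]
  -- The constant 1444 is 4 · 19^2: four pairs of last digits, and at most 18n + 1 ≤ 19n values for
  -- each term.
  calc (2 * (9 * n) + 1) ^ 2 * 4 ≤ (2 * (9 * n) + n) ^ 2 * 4 := by gcongr
    _ = 1444 * n ^ 2 := by ring

theorem FA.IsMinimal.out_length_le {S : Type} [DecidableEq S] {M : FA (Bit × Bit) S}
    (hM : M.IsMinimal) (p : S) : (M.out p).length ≤ 4 := by
  have hnd : ((M.out p).map fun t => t.2.1).Nodup := by
    refine List.Nodup.map_on ?_ (hM.trans_nodup.filter _)
    rintro ⟨p1, a, q1⟩ h1 ⟨p2, b, q2⟩ h2 (hab : a = b)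
    obtain ⟨h1, e1⟩ := FA.mem_out.1 h1
    obtain ⟨h2, e2⟩ := FA.mem_out.1 h2
    obtain rfl : p1 = p2 := e1.trans e2.symm
    subst hab
    exact congrArg (fun q => (p1, a, q)) (hM.det _ _ _ _ h1 h2)
  have := (hnd.subperm (l₂ := pairs) fun a _ => mem_pairs a).length_le
  rwa [List.length_map] at this

theorem FA.out_length_le {A S : Type} [DecidableEq S] (M : FA A S) (p : S) :
    (M.out p).length ≤ M.trans.length :=
  List.length_filter_le _ _

theorem pairs_nodup : pairs.Nodup := by decide

/-! ### One stage of the recursion -/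

/-- The letters over `x`, `y`, `z` projected to `x` and `y`. -/
abbrev takeXY (c : Bit × Bit × Bit) : Bit × Bit := (c.1, c.2.1)

/-- The letters over `x`, `y`, `z` projected to `x` and `z`. -/
abbrev takeXZ (c : Bit × Bit × Bit) : Bit × Bit := (c.1, c.2.2)

/-- The combination of letters `sync` leads from an automaton for `[y] = m [x]` to one for
`[z] = n [x]`: the adder reads the letters `h c`, and `[z] - n [x]` is `k ([y] - m [x])` minus the
value of the word read by the adder. -/
structure IsStage (sync : Bit × Bit → Bit × Bit × Bit → Option (Bit × Bit × Bit))
    (h : Bit × Bit × Bit → Bit × Bit × Bit) (k : ℤ) (m n : ℕ) : Prop where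
  sync_iff : ∀ l m c, sync l m = some c ↔ l = takeXY c ∧ m = h c
  fst : (∀ c, (h c).1 = c.1) ∨ ∀ c, (h c).1 = c.2.1
  snd : ∀ c, (h c).2.1 = c.2.1
  last : ∀ c, (h c).2.2 = c.2.2
  coef : ∀ c, mulCoef n (takeXZ c) + 1 * addCoef (h c) =
    mulCoef m (takeXY c) + (k - 1) * mulCoef m (takeXY c)
  one_le : 1 ≤ k
  le_two : k ≤ 2
  pos : 1 ≤ m
  le : m ≤ n

theorem isStage_double {m : ℕ} (hm : 1 ≤ m) : IsStage syncDouble (fun c => (c.2.1, c.2.1, c.2.2))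
    2 m (2 * m) where
  sync_iff := by decide
  fst := Or.inr fun _ => rfl
  snd _ := rfl
  last _ := rfl
  coef c := by
    simp only [mulCoef, addCoef]
    push_cast
    ring
  one_le := by norm_num
  le_two := le_rfl
  pos := hm
  le := by omega

theorem isStage_add {m : ℕ} (hm : 1 ≤ m) : IsStage syncAdd (fun c => c) 1 m (m + 1) where
  sync_iff := by decide
  fst := Or.inl fun _ => rfl
  snd _ := rfl
  last _ := rfl
  coef c := by
    simp only [mulCoef, addCoef]
    push_cast
    ring
  one_le := le_rfl
  le_two := by norm_num
  pos := hm
  le := by omega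

/-- The nondeterministic automaton in the construction of `existsStep`. -/
def existsNFA (sync : Bit × Bit → Bit × Bit × Bit → Option (Bit × Bit × Bit))
    (M : FA (Bit × Bit) ℕ) : FA (Bit × Bit) ProdState :=
  (relabel takeXZ (product sync M adder'.val).val).val

theorem existsStep_val (sync : Bit × Bit → Bit × Bit × Bit → Option (Bit × Bit × Bit))
    (M : FA (Bit × Bit) ℕ) :
    (existsStep sync M).val = (determinize pairs (existsNFA sync M)).val := by
  unfold existsStep existsNFA
  generalize adder' = a
  rfl

theorem existsStep_time (sync : Bit × Bit → Bit × Bit × Bit → Option (Bit × Bit × Bit))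
    (M : FA (Bit × Bit) ℕ) :
    (existsStep sync M).time = adder'.time + ((product sync M adder'.val).time +
      ((product sync M adder'.val).val.trans.length +
        (determinize pairs (existsNFA sync M)).time)) := by
  unfold existsStep existsNFA
  generalize adder' = a
  rfl

theorem exists_zip (w : List (Bit × Bit)) (y : List Bit) (h : y.length = w.length) :
    ∃ v : List (Bit × Bit × Bit), v.map takeXZ = w ∧ v.map (fun c => c.2.1) = y := by
  induction w generalizing y with
  | nil => exact ⟨[], rfl, (List.length_eq_zero_iff.1 h).symm⟩
  | cons l w ih =>
    cases y with
    | nil => simp at h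
    | cons b y =>
      obtain ⟨v, rfl, rfl⟩ := ih y (by simpa using h)
      exact ⟨(l.1, b, l.2) :: v, rfl, rfl⟩

section Stage

variable {sync : Bit × Bit → Bit × Bit × Bit → Option (Bit × Bit × Bit)}
  {h : Bit × Bit × Bit → Bit × Bit × Bit} {k : ℤ} {m n : ℕ} {M : FA (Bit × Bit) ℕ}

/-- Sequences are linear in the coefficients, so the letterwise identity `coef` passes to whole
words; its two sides are written as c + k d to fit `seqRun_zero_add_mul`. -/
theorem IsStage.run_eq (hs : IsStage sync h k m n) (v : List (Bit × Bit × Bit)) :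
    seqRun (mulCoef n) 0 (v.map takeXZ) + seqRun addCoef 0 (v.map h) =
      k • seqRun (mulCoef m) 0 (v.map takeXY) := by
  have h1 := seqRun_zero_add_mul (fun c => mulCoef n (takeXZ c)) (fun c => addCoef (h c)) 1 v
  have h2 := seqRun_zero_add_mul (fun c => mulCoef m (takeXY c)) (fun c => mulCoef m (takeXY c))
    (k - 1) v
  rw [← funext hs.coef, h1] at h2
  rw [seqRun_map, seqRun_map, seqRun_map]
  rw [one_smul] at h2
  rw [h2, sub_smul, one_smul, add_sub_cancel]

theorem IsStage.existsNFA_path (hs : IsStage sync h k m n) (hM : M.IsDFA) {w : List (Bit × Bit)}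
    {q : ProdState} :
    (existsNFA sync M).Path (existsNFA sync M).start w q ↔ ∃ v : List (Bit × Bit × Bit), v.map takeXZ = w ∧
      M.Path M.start (v.map takeXY) q.1 ∧ adder'.val.Path adder'.val.start (v.map h) q.2 := by
  refine relabel_path.trans (exists_congr fun v => and_congr_right fun _ => ?_)
  exact product_path hM adder'_isDFA hs.sync_iff

theorem IsStage.existsNFA_acc (hs : IsStage sync h k m n) (hM : M.IsDFA)
    {w : List (Bit × Bit)} :
    (existsNFA sync M).Acc (existsNFA sync M).start w ↔ ∃ v : List (Bit × Bit × Bit), v.map takeXZ = w ∧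
      M.Acc M.start (v.map takeXY) ∧ adder'.val.Acc adder'.val.start (v.map h) := by
  refine relabel_acc.trans (exists_congr fun v => and_congr_right fun _ => ?_)
  exact product_acc hM adder'_isDFA hs.sync_iff

theorem IsStage.existsNFA_start_mem (hs : IsStage sync h k m n) (hM : M.IsDFA) :
    (existsNFA sync M).start ∈ (existsNFA sync M).states :=
  product_start_mem hM adder'_isDFA hs.sync_iff

theorem IsStage.existsNFA_trans_mem (hs : IsStage sync h k m n) (hM : M.IsDFA) :
    ∀ t ∈ (existsNFA sync M).trans,
      t.1 ∈ (existsNFA sync M).states ∧ t.2.2 ∈ (existsNFA sync M).states := by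
  intro t ht
  obtain ⟨t, ht', rfl⟩ := List.mem_map.1 ht
  exact product_trans_mem hM adder'_isDFA hs.sync_iff t ht'

theorem IsStage.acc_adder' (hs : IsStage sync h k m n) {v : List (Bit × Bit × Bit)}
    (hx : Valid (v.map fun c => c.1)) (hy : Valid (v.map fun c => c.2.1)) :
    adder'.val.Acc adder'.val.start (v.map h) ↔
      Valid (v.map fun c => c.2.2) ∧ (seqRun addCoef 0 (v.map h)).1 = 0 := by
  rw [adder'_acc]
  · rw [List.map_map]
    simp only [Function.comp_def, hs.last]
  · rw [List.map_map]
    rcases hs.fst with h1 | h1 <;> simpa only [Function.comp_def, h1]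
  · rw [List.map_map]
    simpa only [Function.comp_def, hs.snd]

theorem IsStage.existsStep_acc (hs : IsStage sync h k m n) (hM : IsMulFA m M)
    (w : List (Bit × Bit)) :
    (existsStep sync M).val.Acc (existsStep sync M).val.start w ↔ w ∈ mulLanguage n := by
  rw [existsStep_val, determinize_acc mem_pairs (hs.existsNFA_start_mem hM.toIsDFA)
    (hs.existsNFA_trans_mem hM.toIsDFA), hs.existsNFA_acc hM.toIsDFA]
  constructor
  · rintro ⟨v, rfl, h1, h2⟩
    rw [hM.acc_iff, mem_mulLanguage] at h1
    obtain ⟨hx, hy, h0⟩ := h1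
    simp only [List.map_map, Function.comp_def, ← valid_iff] at hx hy
    obtain ⟨hz, h0'⟩ := (hs.acc_adder' hx hy).1 h2
    have hrun := congrArg Prod.fst (hs.run_eq v)
    rw [Prod.fst_add, h0', Prod.smul_fst, h0] at hrun
    rw [mem_mulLanguage, List.map_map, List.map_map, ← valid_iff, ← valid_iff]
    exact ⟨hx, hz, by simpa using hrun⟩
  · intro hw
    obtain ⟨hx, hz, hval⟩ : Valid (w.map Prod.fst) ∧ Valid (w.map Prod.snd) ∧
      fibVal (w.map Prod.snd) = n * fibVal (w.map Prod.fst) := id hw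
    -- The existential quantifier needs a `y` of the same length as `z`. There is room for one
    -- without extra leading zeros because m[x] ≤ n[x] = [z].
    have hlt : m * fibVal (w.map Prod.fst) < Nat.fib (w.length + 2) := by
      refine (Nat.mul_le_mul_right _ hs.le).trans_lt ?_
      rw [← hval]
      simpa using (fibVal_lt (w.map Prod.snd)).1 (valid_iff.1 hz)
    obtain ⟨y, hlen, hy, hyval⟩ := (exists_representation w.length).1 _ hlt
    obtain ⟨v, rfl, rfl⟩ := exists_zip w y hlen
    have hmem : v.map takeXY ∈ mulLanguage m := by
      refine ⟨?_, ?_, ?_⟩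
      · simpa only [List.map_map, Function.comp_def] using hx
      · simpa only [List.map_map, Function.comp_def] using valid_iff.2 hy
      · simpa only [List.map_map, Function.comp_def] using hyval
    refine ⟨v, rfl, (hM.acc_iff _).2 hmem, ?_⟩
    have hrun := congrArg Prod.fst (hs.run_eq v)
    rw [Prod.fst_add, Prod.smul_fst, (mem_mulLanguage.1 hmem).2.2,
      (mem_mulLanguage.1 hw).2.2] at hrun
    simp only [List.map_map, Function.comp_def] at hx hz
    exact (hs.acc_adder' hx (valid_iff.2 hy)).2 ⟨hz, by simpa using hrun⟩

/-- What a state of the subset construction can hold besides what is determined by the word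
read. -/
def stateTypes : Finset (Bit × AddState × AddState × Bit) :=
  Finset.univ ×ˢ addStates.toFinset ×ˢ addStates.toFinset ×ˢ Finset.univ

/-- A bound on the number of states of the subset construction, divided by `n ^ 2`. -/
def subsetConst : ℕ := 4802 * 2 ^ stateTypes.card

/-- The set reached by a word x × z can be rebuilt from three data: the pair `E` of [z] - n[x], the
last digit of x, and the set `T` of the last digits of y together with the adder states that occur
with them. Only `E` has a range that grows with n. -/
theorem IsStage.existsStep_states_length_le (hs : IsStage sync h k m n) (hM : IsMulFA m M) :
    (existsStep sync M).val.states.length ≤ subsetConst * n ^ 2 := by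
  classical
  have hst := hs.existsNFA_start_mem hM.toIsDFA
  have htr := hs.existsNFA_trans_mem hM.toIsDFA
  have hn : 1 ≤ n := hs.pos.trans hs.le
  obtain ⟨ρ, hρ⟩ := hM.exists_stateOfKey
  rw [existsStep_val,
    ← List.toFinset_card_of_nodup (determinize_isDFA mem_pairs hst htr).nodup]
  -- The decoder: the key of x × y has the pair (E + adder pair) / k, and `ρ` turns this key into
  -- the state of `M`.
  let Ψ : (ℤ × ℤ) × Bit × Finset (Bit × AddState × AddState × Bit) → Finset ProdState :=
    fun i => i.2.2.image fun r =>
      (ρ (((i.1.1 + r.2.1.1) / k, (i.1.2 + r.2.1.2) / k), i.2.1, r.1), r.2)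
  have hsub : (determinize pairs (existsNFA sync M)).val.states.toFinset ⊆
      (intBox (24 * n) ×ˢ (Finset.univ : Finset Bit) ×ˢ stateTypes.powerset).image Ψ := by
    intro U hU
    obtain ⟨w, hw⟩ := determinize_accessible mem_pairs hst htr U (List.mem_toFinset.1 hU)
    obtain ⟨hne, hUw⟩ := (determinize_path mem_pairs hst htr).1 hw
    set E := seqRun (mulCoef n) 0 w with hE
    set T := stateTypes.filter fun r => ∃ v : List (Bit × Bit × Bit), v.map takeXZ = w ∧
      endBit 0 (v.map fun c => c.2.1) = r.1 ∧ (∃ q, M.Path M.start (v.map takeXY) q) ∧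
      adder'.val.Path adder'.val.start (v.map h) r.2 with hT
    -- The division by k is exact, because by `run_eq` the sum is k times the pair for x × y.
    have hkey : ∀ v : List (Bit × Bit × Bit), v.map takeXZ = w →
        ∀ q a, M.Path M.start (v.map takeXY) q →
        adder'.val.Path adder'.val.start (v.map h) a →
        ρ (((E.1 + a.1.1) / k, (E.2 + a.1.2) / k), endBit 0 (w.map Prod.fst),
          endBit 0 (v.map fun c => c.2.1)) = q := by
      rintro v rfl q a hq ha
      rw [← hρ _ q hq, (adder'_path ha).1, mulKey]
      have hrun := hs.run_eq v
      have hk : k ≠ 0 := by have := hs.one_le; omega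
      have e1 : E.1 + (seqRun addCoef 0 (v.map h)).1 =
          k * (seqRun (mulCoef m) 0 (v.map takeXY)).1 := congrArg Prod.fst hrun
      have e2 : E.2 + (seqRun addCoef 0 (v.map h)).2 =
          k * (seqRun (mulCoef m) 0 (v.map takeXY)).2 := congrArg Prod.snd hrun
      rw [e1, e2, Int.mul_ediv_cancel_left _ hk, Int.mul_ediv_cancel_left _ hk]
      simp only [List.map_map, Function.comp_def]
    refine Finset.mem_image.2 ⟨(E, endBit 0 (w.map Prod.fst), T), ?_, ?_⟩
    -- The bound 24n: a nonempty set provides some y, whose pair is at most 9m ≤ 9n in absolute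
    -- value. Multiplication by k ≤ 2 and subtraction of an adder pair of size at most 6 give at
    -- most 18n + 6.
    · refine Finset.mem_product.2 ⟨mem_intBox.2 ?_, Finset.mem_product.2 ⟨Finset.mem_univ _,
        Finset.mem_powerset.2 (Finset.filter_subset _ _)⟩⟩
      obtain ⟨⟨q, a⟩, hqa⟩ := hne
      obtain ⟨v, hv, hq, ha⟩ := (hs.existsNFA_path hM.toIsDFA).1 ((hUw _).1 hqa)
      obtain ⟨e1, e2, -⟩ := adder'_path ha
      obtain ⟨b1, b2⟩ := abs_le_of_mem_addStates e2
      obtain ⟨b3, b4⟩ := hM.run_bounded hs.pos hq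
      have hrun := hs.run_eq v
      rw [hv, ← hE] at hrun
      have e3 : E.1 + (seqRun addCoef 0 (v.map h)).1 =
          k * (seqRun (mulCoef m) 0 (v.map takeXY)).1 := congrArg Prod.fst hrun
      have e4 : E.2 + (seqRun addCoef 0 (v.map h)).2 =
          k * (seqRun (mulCoef m) 0 (v.map takeXY)).2 := congrArg Prod.snd hrun
      rw [e1] at b1 b2
      rw [abs_le] at b1 b2 b3 b4
      have hmn := hs.le
      have hk : k = 1 ∨ k = 2 := by
        have := hs.one_le
        have := hs.le_two
        omega
      push_cast
      rw [abs_le, abs_le]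
      rcases hk with rfl | rfl <;> refine ⟨⟨?_, ?_⟩, ?_, ?_⟩ <;> omega
    · ext ⟨q, a⟩
      rw [hUw, hs.existsNFA_path hM.toIsDFA, Finset.mem_image]
      constructor
      · rintro ⟨⟨ly, a'⟩, hr, e⟩
        obtain ⟨-, v, hv, rfl, ⟨q', hq'⟩, ha⟩ := Finset.mem_filter.1 hr
        have e1 := hkey v hv q' a' hq' ha
        obtain ⟨rfl, rfl⟩ := Prod.mk.injEq _ _ _ _ ▸ e
        exact ⟨v, hv, e1.symm ▸ hq', ha⟩
      · rintro ⟨v, hv, hq, ha⟩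
        obtain ⟨-, e2, e3, -⟩ := adder'_path ha
        refine ⟨(endBit 0 (v.map fun c => c.2.1), a), Finset.mem_filter.2
          ⟨?_, v, hv, rfl, ⟨q, hq⟩, ha⟩, ?_⟩
        · simp only [stateTypes, Finset.mem_product, Finset.mem_univ, List.mem_toFinset, true_and,
            and_true]
          exact ⟨e2, e3⟩
        · exact Prod.ext (hkey v hv q a hq ha) rfl
  refine (Finset.card_le_card hsub).trans (Finset.card_image_le.trans ?_)
  rw [Finset.card_product, Finset.card_product, card_intBox, Finset.card_powerset, subsetConst]
  have h2 : (Finset.univ : Finset Bit).card = 2 := rfl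
  rw [h2]
  -- The constant 4802 is 2 · 49^2, from 48n + 1 ≤ 49n and the two values of the last digit.
  calc (2 * (24 * n) + 1) ^ 2 * (2 * 2 ^ stateTypes.card)
      ≤ (2 * (24 * n) + n) ^ 2 * (2 * 2 ^ stateTypes.card) := by gcongr
    _ = 4802 * 2 ^ stateTypes.card * n ^ 2 := by ring

end Stage

/-! ### The base case n = 1 and the initial loop -/

theorem bit_cases (b : Bit) : b = 0 ∨ b = 1 := by
  revert b
  decide

/-- The value fixes the leading digit, as a valid word starting with 0 stays below the weight of a
leading 1. The preceding digits `e` and `e'` are left free so that the induction can pass to the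
tails. -/
theorem eq_of_fibVal_eq {e e' : Bit} {x y : List Bit} (hx : NoConsec e x) (hy : NoConsec e' y)
    (hlen : x.length = y.length) (h : fibVal x = fibVal y) : x = y := by
  have key : ∀ x y : List Bit, NoConsec 0 y → x.length = y.length →
      fibVal (1 :: x) ≠ fibVal (0 :: y) := by
    intro x y hy hlen he
    rw [fibVal_zero_cons, fibVal_one_cons, hlen] at he
    have := (fibVal_lt y).1 hy
    omega
  induction x generalizing y e e' with
  | nil => exact (List.length_eq_zero_iff.1 hlen.symm).symm
  | cons a x ih =>
    cases y with
    | nil => simp at hlen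
    | cons b y =>
      have hlen' : x.length = y.length := by simpa using hlen
      rcases bit_cases a with rfl | rfl <;>
        rcases bit_cases b with rfl | rfl
      · rw [fibVal_zero_cons, fibVal_zero_cons] at h
        rw [ih hx.2 hy.2 hlen' h]
      · exact absurd h.symm (key y x hx.2 hlen'.symm)
      · exact absurd h (key x y hy.2 hlen')
      · rw [fibVal_one_cons, fibVal_one_cons, hlen'] at h
        rw [ih hx.2 hy.2 hlen' (Nat.add_left_cancel h)]

theorem mem_equality_trans {e : Bit} {a : Bit × Bit} {r : ℕ} :
    (e.val, a, r) ∈ equality.trans ↔ a.1 = a.2 ∧ ¬ (e = 1 ∧ a.1 = 1) ∧ r = a.1.val := by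
  obtain ⟨a, b⟩ := a
  simp only [equality, List.mem_cons, List.not_mem_nil, or_false, Prod.mk.injEq]
  fin_cases e <;> fin_cases a <;> fin_cases b <;> simp

theorem equality_acc {e : Bit} {w : List (Bit × Bit)} : equality.Acc e.val w ↔
    w.map Prod.fst = w.map Prod.snd ∧ NoConsec e (w.map Prod.fst) := by
  induction w generalizing e with
  | nil =>
    refine iff_of_true ⟨e.val, ?_, rfl⟩ ⟨rfl, trivial⟩
    revert e
    decide
  | cons a w ih =>
    rw [FA.acc_cons]
    simp only [mem_equality_trans, List.map_cons, List.cons.injEq, NoConsec]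
    constructor
    · rintro ⟨r, ⟨h1, h2, rfl⟩, hw⟩
      obtain ⟨h3, h4⟩ := ih.1 hw
      exact ⟨⟨h1, h3⟩, h2, h4⟩
    · rintro ⟨⟨h1, h3⟩, h2, h4⟩
      exact ⟨_, ⟨h1, h2, rfl⟩, ih.2 ⟨h3, h4⟩⟩

theorem mem_equality_states {q : ℕ} : q ∈ equality.states ↔ ∃ e : Bit, e.val = q := by
  constructor
  · intro h
    have : q < 2 := by
      revert q
      decide
    exact ⟨⟨q, this⟩, rfl⟩
  · rintro ⟨e, rfl⟩
    revert e
    decide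

theorem equality_isMulFA : IsMulFA 1 equality where
  nodup := by decide
  start_mem := by decide
  final_mem := by decide
  trans_mem := by decide
  det p a q r hq hr := by
    have hp : p ∈ equality.states :=
      (by decide : ∀ t ∈ equality.trans, t.1 ∈ equality.states) _ hq
    obtain ⟨e, rfl⟩ := mem_equality_states.1 hp
    exact (mem_equality_trans.1 hq).2.2.trans (mem_equality_trans.1 hr).2.2.symm
  accessible q hq := by
    obtain ⟨e, rfl⟩ := mem_equality_states.1 hq
    refine ⟨[(e, e)], e.val, (mem_equality_trans (e := 0)).2 ⟨rfl, by simp, rfl⟩, rfl⟩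
  coaccessible q hq := by
    obtain ⟨e, rfl⟩ := mem_equality_states.1 hq
    exact ⟨[], equality_acc.2 ⟨rfl, trivial⟩⟩
  distinct p hp q hq h := by
    obtain ⟨e, rfl⟩ := mem_equality_states.1 hp
    obtain ⟨e', rfl⟩ := mem_equality_states.1 hq
    have h1 := h [(1, 1)]
    simp only [equality_acc, List.map_cons, List.map_nil, NoConsec, and_true, true_and,
      not_iff_not] at h1
    have key : ∀ e e' : Bit, (e = 1 ↔ e' = 1) → e = e' := by decide
    rw [key e e' h1]
  trans_nodup := by decide
  acc_iff w := by
    refine (equality_acc (e := 0)).trans ⟨?_, ?_⟩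
    · rintro ⟨h1, h2⟩
      refine ⟨valid_iff.2 h2, valid_iff.2 (h1 ▸ h2), ?_⟩
      rw [h1, one_mul]
    · rintro ⟨h1, h2, h3⟩
      rw [valid_iff] at h1 h2
      exact ⟨(eq_of_fibVal_eq h2 h1 (by simp) (by rw [h3, one_mul])).symm, h1⟩

/-- A leading [0,0] leaves membership unchanged. The word [0,0] is accepted, so the transition
exists; its target has the same language as the initial state, and minimality makes them equal. -/
theorem IsMulFA.start_loop {n : ℕ} {M : FA (Bit × Bit) ℕ} (hM : IsMulFA n M) :
    (M.start, (0, 0), M.start) ∈ M.trans := by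
  have hL : ∀ w, (0, 0) :: w ∈ mulLanguage n ↔ w ∈ mulLanguage n := by
    intro w
    rw [mem_mulLanguage, mem_mulLanguage]
    have : seqNext 0 (mulCoef n (0, 0)) = 0 := by simp [seqNext, mulCoef]
    simp [NoConsec, seqRun, this]
  have hnil : [] ∈ mulLanguage n := mem_mulLanguage.2 ⟨trivial, trivial, rfl⟩
  obtain ⟨q, hq, -⟩ := FA.acc_cons.1 ((hM.acc_iff _).2 ((hL []).2 hnil))
  have : M.start = q := by
    refine hM.distinct _ hM.start_mem _ (hM.trans_mem _ hq).2 fun w => ?_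
    rw [← hM.acc_append (v := [(0, 0)]) (p := M.start) ⟨q, hq, rfl⟩, hM.acc_iff, hM.acc_iff]
    exact (hL w).symm
  rwa [← this] at hq

/-! ### Time of one stage and of the recursion -/

/-- A bound on the number of states of the product, divided by `n ^ 2`. -/
def productConst : ℕ := 1444 * adder'.val.states.length

/-- A bound on the number of transitions of the product, divided by `n ^ 2`. -/
def productTransConst : ℕ := productConst * (4 * adder'.val.trans.length)

/-- A bound on the time of one stage, divided by `n ^ 4`. -/
def stageConst : ℕ :=
  adder'.time + productConst * (1 + 4 * adder'.val.trans.length) + productTransConst +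
    subsetConst * (5 + productTransConst) + (5 * subsetConst + 10) * (1 + 4 * subsetConst) +
    subsetConst

/-- Here x stands for n^2: the product and its transitions as well as the subset automaton are
linear in x, and only products of two such quantities occur. -/
theorem stage_time_le {x a P t S T A Q B K s : ℕ} (hx : 1 ≤ x) (hA : A ≤ a)
    (hQ : P ≤ B * x) (ht : T ≤ Q * x) (hS : S ≤ K * x) (hs : t = 4) :
    A + (P * (1 + 4 * s) + (T + S * (1 + (T + t)))) +
      ((S + t * (S + 2) + 2) * (1 + S * t) + S) ≤
    (a + B * (1 + 4 * s) + Q + K * (5 + Q) + (5 * K + 10) * (1 + 4 * K) + K) * x ^ 2 := by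
  subst hs
  have hxx : x ≤ x ^ 2 := Nat.le_self_pow (by norm_num) x
  calc _ ≤ a + (B * x * (1 + 4 * s) + (Q * x + K * x * (1 + (Q * x + 4)))) +
        ((K * x + 4 * (K * x + 2) + 2) * (1 + K * x * 4) + K * x) := by gcongr
    _ = a * 1 + (B * (1 + 4 * s) + Q + K) * x + (K * x) * (5 * 1 + Q * x) +
        (5 * (K * x) + 10 * 1) * (1 + 4 * (K * x)) := by ring
    _ ≤ a * x ^ 2 + (B * (1 + 4 * s) + Q + K) * x ^ 2 + (K * x) * (5 * x + Q * x) +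
        (5 * (K * x) + 10 * x) * (x + 4 * (K * x)) := by
      gcongr
      exact Nat.one_le_pow _ _ hx
    _ = _ := by ring

section Stage

variable {sync : Bit × Bit → Bit × Bit × Bit → Option (Bit × Bit × Bit)}
  {h : Bit × Bit × Bit → Bit × Bit × Bit} {k : ℤ} {m n : ℕ} {M : FA (Bit × Bit) ℕ}

theorem IsStage.minimize_spec (hs : IsStage sync h k m n) (hM : IsMulFA m M) :
    IsMulFA n (minimize pairs (existsStep sync M).val).val ∧
      (existsStep sync M).time + (minimize pairs (existsStep sync M).val).time ≤
        stageConst * n ^ 4 := by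
  have hst := hs.existsNFA_start_mem hM.toIsDFA
  have htr := hs.existsNFA_trans_mem hM.toIsDFA
  have hacc := hs.existsStep_acc hM
  have hlen := hs.existsStep_states_length_le hM
  have htime := existsStep_time sync M
  have hn : 1 ≤ n := hs.pos.trans hs.le
  rw [existsStep_val] at hacc hlen ⊢
  have hD := determinize_isDFA mem_pairs hst htr
  have hf : (determinize pairs (existsNFA sync M)).val.final.Nodup := hD.nodup.filter _
  have hnil : [] ∈ mulLanguage n := mem_mulLanguage.2 ⟨trivial, trivial, rfl⟩
  obtain ⟨h1, h2, h3⟩ := FibAut.minimize_spec hD hf (determinize_accessible mem_pairs hst htr)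
    ⟨[], (hacc _).2 hnil⟩ mem_pairs pairs_nodup
  refine ⟨⟨h1, fun w => (h2 w).trans (hacc w)⟩, ?_⟩
  have hpt := product_time_le hM.toIsDFA adder'_isDFA hs.sync_iff hM.out_length_le
    (FA.out_length_le adder'.val)
  have hptr := product_trans_length_le hM.toIsDFA adder'_isDFA hs.sync_iff hM.out_length_le
    (FA.out_length_le adder'.val)
  have hps := product_states_length hM.toIsDFA adder'_isDFA hs.sync_iff
  have hNtr : (existsNFA sync M).trans.length =
      (product sync M adder'.val).val.trans.length := List.length_map _
  have hdt := determinize_time_le (letters := pairs) mem_pairs hst htr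
  have hdtr := determinize_trans_length_le (letters := pairs) mem_pairs hst htr
  rw [hNtr] at hdt
  have hMs : M.states.length ≤ 1444 * n ^ 2 :=
    (hM.states_length_le hs.pos).trans (by gcongr; exact hs.le)
  have hps' : (product sync M adder'.val).val.states.length ≤ productConst * n ^ 2 := by
    refine hps.trans ((Nat.mul_le_mul_right _ hMs).trans_eq ?_)
    rw [productConst]
    ring
  have hptr' : (product sync M adder'.val).val.trans.length ≤ productTransConst * n ^ 2 := by
    refine hptr.trans ((Nat.mul_le_mul_right _ hps').trans_eq ?_)
    rw [productTransConst]
    ring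
  have hbound := stage_time_le (s := adder'.val.trans.length) (A := adder'.time)
    (Nat.one_le_pow 2 n hn) le_rfl hps' hptr' hlen (t := pairs.length) rfl
  rw [← pow_mul] at hbound
  rw [htime]
  refine le_trans ?_ hbound
  refine Nat.add_le_add (Nat.add_le_add_left (Nat.add_le_add hpt
    (Nat.add_le_add_left hdt _)) _) (h3.trans ?_)
  gcongr

end Stage

theorem mulFA_add_two_even {n : ℕ} (h : (n + 2) % 2 = 0) : mulFA (n + 2) = (do
    let M ← mulFA ((n + 2) / 2)
    let D ← existsStep syncDouble M
    minimize pairs D) := by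
  rw [mulFA, if_pos h]

theorem mulFA_add_two_odd {n : ℕ} (h : (n + 2) % 2 ≠ 0) : mulFA (n + 2) = (do
    let M ← mulFA (n + 1)
    let D ← existsStep syncAdd M
    minimize pairs D) := by
  rw [mulFA, if_neg h]

/-- Only m < n is used about the previous stage: m^5 + n^4 ≤ (n - 1) n^4 + n^4 = n^5. The summand 3
pays for the three transitions of the automaton for n = 1. -/
theorem mulFA_spec (n : ℕ) (hn : 1 ≤ n) :
    IsMulFA n (mulFA n).val ∧ (mulFA n).time ≤ (stageConst + 3) * n ^ 5 := by
  have hstep : ∀ n m t s : ℕ, m < n → t ≤ (stageConst + 3) * m ^ 5 → s ≤ stageConst * n ^ 4 →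
      t + s ≤ (stageConst + 3) * n ^ 5 := by
    intro n m t s hmn ht hs
    obtain ⟨k, rfl⟩ : ∃ k, n = k + 1 := ⟨n - 1, by omega⟩
    calc t + s ≤ (stageConst + 3) * m ^ 5 + (stageConst + 3) * (k + 1) ^ 4 := by
          gcongr
          exact hs.trans (Nat.mul_le_mul_right _ (by omega))
      _ = (stageConst + 3) * (m ^ 4 * m + (k + 1) ^ 4) := by ring
      _ ≤ (stageConst + 3) * ((k + 1) ^ 4 * k + (k + 1) ^ 4) := by
          gcongr
          all_goals omega
      _ = _ := by ring
  induction n using Nat.strong_induction_on with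
  | _ n ih =>
    match n, hn with
    | 1, _ =>
      rw [mulFA]
      exact ⟨equality_isMulFA, by simp [equality]⟩
    | n + 2, _ =>
      by_cases h : (n + 2) % 2 = 0
      · rw [mulFA_add_two_even h]
        obtain ⟨h1, h2⟩ := ih ((n + 2) / 2) (by omega) (by omega)
        have hst := isStage_double (m := (n + 2) / 2) (by omega)
        rw [show 2 * ((n + 2) / 2) = n + 2 by omega] at hst
        obtain ⟨h3, h4⟩ := hst.minimize_spec h1
        exact ⟨h3, hstep _ _ _ _ (by omega) h2 h4⟩
      · rw [mulFA_add_two_odd h]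
        obtain ⟨h1, h2⟩ := ih (n + 1) (by omega) (by omega)
        obtain ⟨h3, h4⟩ := (isStage_add (m := n + 1) (by omega)).minimize_spec h1
        exact ⟨h3, hstep _ _ _ _ (by omega) h2 h4⟩

theorem subsetFA_states_length_le {n : ℕ} (hn : 2 ≤ n) :
    (subsetFA n).states.length ≤ subsetConst * n ^ 2 := by
  rw [subsetFA]
  split_ifs with h
  · have hst := isStage_double (m := n / 2) (by omega)
    rw [show 2 * (n / 2) = n by omega] at hst
    exact hst.existsStep_states_length_le (mulFA_spec _ (by omega)).1
  · have hst := isStage_add (m := n - 1) (by omega)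
    rw [show n - 1 + 1 = n by omega] at hst
    exact hst.existsStep_states_length_le (mulFA_spec _ (by omega)).1

end FibAut

theorem theorem20 :
    ∃ C : ℝ, ∀ n : ℕ, 1 ≤ n →
      (FibAut.mulFA n).val.IsDFA ∧
      (FibAut.mulFA n).val.toNFA.accepts = FibAut.mulLanguage n ∧
      ((FibAut.mulFA n).val.start, (0, 0), (FibAut.mulFA n).val.start) ∈
        (FibAut.mulFA n).val.trans ∧
      ((FibAut.mulFA n).time : ℝ) ≤ C * (n : ℝ) ^ 6 * (max 1 (Real.log n)) ^ 2 ∧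
      (2 ≤ n → ((FibAut.subsetFA n).states.length : ℝ) ≤ C * (n : ℝ) ^ 6) := by
  -- The bounds proved are of order n^5 for the time and n^2 for the subsets; this sum dominates
  -- both constants.
  refine ⟨((FibAut.stageConst + 3 + FibAut.subsetConst : ℕ) : ℝ), fun n hn => ?_⟩
  obtain ⟨hM, htime⟩ := FibAut.mulFA_spec n hn
  refine ⟨hM.toIsDFA, ?_, hM.start_loop, ?_, fun hn2 => ?_⟩
  · ext w
    exact FibAut.FA.mem_accepts.trans (hM.acc_iff w)
  · have h1 : (FibAut.mulFA n).time ≤ (FibAut.stageConst + 3 + FibAut.subsetConst) * n ^ 6 :=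
      htime.trans (Nat.mul_le_mul (Nat.le_add_right _ _) (Nat.pow_le_pow_right hn (by norm_num)))
    have h2 : ((FibAut.mulFA n).time : ℝ) ≤
        ((FibAut.stageConst + 3 + FibAut.subsetConst : ℕ) : ℝ) * (n : ℝ) ^ 6 := by
      exact_mod_cast h1
    exact h2.trans (le_mul_of_one_le_right
      (mul_nonneg (Nat.cast_nonneg _) (pow_nonneg (Nat.cast_nonneg _) _))
      (one_le_pow₀ (le_max_left 1 (Real.log n))))
  · have h1 : (FibAut.subsetFA n).states.length ≤
        (FibAut.stageConst + 3 + FibAut.subsetConst) * n ^ 6 :=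
      (FibAut.subsetFA_states_length_le hn2).trans
        (Nat.mul_le_mul (Nat.le_add_left _ _) (Nat.pow_le_pow_right hn (by norm_num)))
    exact_mod_cast h1
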